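/- Let $L$ be the first-order language with a binary relation symbol $<$, a binary function symbol $\times$ (also written $\cdot$), a unary function symbol $\square^{-1}$, and constants $\mathbf{-1},\mathbf 0,\mathbf 1$. Regard $\mathbb R$ as an $L$-structure in the usual way, with the convention $0^{-1}=0$. Write $x^n$ for the product of $n$ copies of $x$. The infinite theory consisting of the axioms - $\forall x,y\,(x<y\rightarrow y\not<x)$, - $\forall x,y,z\,(x<y<z\rightarrow x<z)$, - $\forall x,y\,(x<y\vee x=y\vee y<x)$, - $\forall x,y,z\,(x\cdot(y\cdot z)=(x\cdot y)\cdot z)$, - $\forall x\,(x\cdot\mathbf 1=x\wedge x\cdot\mathbf 0=\mathbf 0=\mathbf 0^{-1})$, - $\forall x\,(x\ne\mathbf 0\rightarrow x\cdot x^{-1}=\mathbf 1)$, - $\forall x,y\,(x\cdot y=y\cdot x)$, - $\forall x,y,z\,(x<y\wedge\mathbf 0<z\rightarrow x\cdot z<y\cdot z)$, - $\forall x,y,z\,(x<y\wedge z<\mathbf 0\rightarrow y\cdot z<x\cdot z)$, - $\exists y\,(\mathbf{-1}<\mathbf 0<\mathbf 1<y)$, - $\forall x\exists y\,(x=y^{2n+1})$,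 for every natural number $n$, - $\forall x\,(x^{2n}=\mathbf 1\leftrightarrow x=\mathbf 1\vee x=\mathbf{-1})$, for every natural number $n\ge 1$, - $\forall x\,(\mathbf 0<x\leftrightarrow\exists y\,[y\ne\mathbf 0\wedge x=y^2])$ completely axiomatizes the order and multiplicative theory of the real numbers: an $L$-sentence follows from these axioms if and only if it is true in $\langle\mathbb R;<,\times,\square^{-1},\mathbf{-1},\mathbf 0,\mathbf 1\rangle$; in particular, a $\{<,\times\}$-sentence follows from them if and only if it is true in $\langle\mathbb R;<,\times\rangle$. Moreover, the structure $\langle\mathbb R;<,\times,\square^{-1},\mathbf{-1},\mathbf 0,\mathbf 1\rangle$ admits quantifier elimination (every formula is equivalent in it to a quantifier-free formula in the same free variables), and its theory is decidable (the set of Gödel numbers of the $L$-sentences true in it is computable). -/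

import Mathlib

open FirstOrder FirstOrder.Language

namespace OrdMul

/-- Function symbols of the language with order, multiplication, inverse and constants
`-1`, `0`, `1`. -/
inductive Func : ℕ → Type
  | negOne : Func 0
  | zero : Func 0
  | one : Func 0
  | inv : Func 1
  | mul : Func 2

/-- The only relation symbol, a binary `<`. -/
inductive Rel : ℕ → Type
  | lt : Rel 2

/-- The only function symbol of the small language, a binary multiplication. -/
inductive MulFunc : ℕ → Type
  | mul : MulFunc 2

/-- The language `{<, ×, ⁻¹, -1, 0, 1}`. -/
abbrev Lang : FirstOrder.Language.{0, 0} := ⟨Func, Rel⟩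

/-- The language `{<, ×}`. -/
abbrev BaseLang : FirstOrder.Language.{0, 0} := ⟨MulFunc, Rel⟩

/-- The inclusion of `{<, ×}` into `{<, ×, ⁻¹, -1, 0, 1}`. -/
def incl : BaseLang →ᴸ Lang where
  onFunction := fun _ f => match f with
    | MulFunc.mul => Func.mul
  onRelation := fun _ r => r

/-- The structure `⟨ℝ; <, ×, ⁻¹, -1, 0, 1⟩`, with `0⁻¹ = 0`. -/
noncomputable instance realStructure : Lang.Structure ℝ where
  funMap := fun f v => match f, v with
    | Func.negOne, _ => -1
    | Func.zero, _ => 0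
    | Func.one, _ => 1
    | Func.inv, v => (v 0)⁻¹
    | Func.mul, v => v 0 * v 1
  RelMap := fun r v => match r, v with
    | Rel.lt, v => v 0 < v 1

/-- The structure `⟨ℝ; <, ×⟩`. -/
noncomputable instance realBaseStructure : BaseLang.Structure ℝ where
  funMap := fun f v => match f, v with
    | MulFunc.mul, v => v 0 * v 1
  RelMap := fun r v => match r, v with
    | Rel.lt, v => v 0 < v 1

section Terms

variable {α : Type} {n : ℕ}

/-- The constant term `-1`. -/
def tNegOne : Lang.Term α := Term.func Func.negOne ![]

/-- The constant term `0`. -/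
def tZero : Lang.Term α := Term.func Func.zero ![]

/-- The constant term `1`. -/
def tOne : Lang.Term α := Term.func Func.one ![]

/-- The term `t⁻¹`. -/
def tInv (t : Lang.Term α) : Lang.Term α := Term.func Func.inv ![t]

/-- The term `s · t`. -/
def tMul (s t : Lang.Term α) : Lang.Term α := Term.func Func.mul ![s, t]

/-- The term `tⁿ = t · t · … · t` (`n` times); `t⁰` is the constant `1`. -/
def tPow (t : Lang.Term α) : ℕ → Lang.Term α
  | 0 => tOne
  | 1 => t
  | k + 2 => tMul (tPow t (k + 1)) t

/-- The atomic formula `s < t`. -/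
def fLt (s t : Lang.Term (α ⊕ Fin n)) : Lang.BoundedFormula α n :=
  BoundedFormula.rel Rel.lt ![s, t]

end Terms

/-! The axioms. In them the quantified variables are, from the outermost to the innermost
quantifier, `&0`, `&1`, `&2`. -/

/-- `∀ x y, x < y → ¬ y < x` -/
def axO1 : Lang.Sentence := ∀' ∀' (fLt (&0) (&1) ⟹ ∼(fLt (&1) (&0)))

/-- `∀ x y z, x < y < z → x < z` -/
def axO2 : Lang.Sentence := ∀' ∀' ∀' ((fLt (&0) (&1) ⊓ fLt (&1) (&2)) ⟹ fLt (&0) (&2))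

/-- `∀ x y, x < y ∨ x = y ∨ y < x` -/
def axO3 : Lang.Sentence := ∀' ∀' (fLt (&0) (&1) ⊔ (((&0) =' (&1)) ⊔ fLt (&1) (&0)))

/-- `∀ x y z, x · (y · z) = (x · y) · z` -/
def axM1 : Lang.Sentence :=
  ∀' ∀' ∀' ((tMul (&0) (tMul (&1) (&2))) =' (tMul (tMul (&0) (&1)) (&2)))

/-- `∀ x, x · 1 = x ∧ x · 0 = 0 ∧ 0 = 0⁻¹` -/
def axM2 : Lang.Sentence :=
  ∀' (((tMul (&0) tOne) =' (&0)) ⊓ (((tMul (&0) tZero) =' tZero) ⊓ (tZero =' (tInv tZero))))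

/-- `∀ x, x ≠ 0 → x · x⁻¹ = 1` -/
def axM3 : Lang.Sentence := ∀' (∼((&0) =' tZero) ⟹ ((tMul (&0) (tInv (&0))) =' tOne))

/-- `∀ x y, x · y = y · x` -/
def axM4 : Lang.Sentence := ∀' ∀' ((tMul (&0) (&1)) =' (tMul (&1) (&0)))

/-- `∀ x y z, x < y ∧ 0 < z → x · z < y · z` -/
def axM5pos : Lang.Sentence :=
  ∀' ∀' ∀' ((fLt (&0) (&1) ⊓ fLt tZero (&2)) ⟹ fLt (tMul (&0) (&2)) (tMul (&1) (&2)))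

/-- `∀ x y z, x < y ∧ z < 0 → y · z < x · z` -/
def axM5neg : Lang.Sentence :=
  ∀' ∀' ∀' ((fLt (&0) (&1) ⊓ fLt (&2) tZero) ⟹ fLt (tMul (&1) (&2)) (tMul (&0) (&2)))

/-- `∃ y, -1 < 0 < 1 < y` -/
def axM6 : Lang.Sentence := ∃' (fLt tNegOne tZero ⊓ (fLt tZero tOne ⊓ fLt tOne (&0)))

/-- `∀ x, ∃ y, x = y ^ (2n+1)` -/
def axM7 (n : ℕ) : Lang.Sentence := ∀' ∃' ((&0) =' (tPow (&1) (2 * n + 1)))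

/-- `∀ x, x ^ (2n) = 1 ↔ x = 1 ∨ x = -1` (an axiom for `n ≥ 1` only) -/
def axM8 (n : ℕ) : Lang.Sentence :=
  ∀' (((tPow (&0) (2 * n)) =' tOne) ⇔ (((&0) =' tOne) ⊔ ((&0) =' tNegOne)))

/-- `∀ x, 0 < x ↔ ∃ y, y ≠ 0 ∧ x = y ^ 2` -/
def axM9 : Lang.Sentence :=
  ∀' (fLt tZero (&0) ⇔ ∃' (∼((&1) =' tZero) ⊓ ((&0) =' (tPow (&1) 2))))

/-- The axiom system for the real numbers with order and multiplication. -/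
def realTheory : Lang.Theory :=
  {axO1, axO2, axO3, axM1, axM2, axM3, axM4, axM5pos, axM5neg, axM6, axM9}
    ∪ {φ | ∃ n : ℕ, φ = axM7 n} ∪ {φ | ∃ n : ℕ, 1 ≤ n ∧ φ = axM8 n}

/-- A structure admits quantifier elimination if every formula, with free variables from a set
`α`, is equivalent in it to a quantifier-free formula with free variables from the same set. -/
def HasQE (L : FirstOrder.Language.{0, 0}) (M : Type) [L.Structure M] : Prop :=
  ∀ (α : Type) (φ : L.Formula α), ∃ ψ : L.Formula α,
    BoundedFormula.IsQF ψ ∧ ∀ v : α → M, φ.Realize v ↔ ψ.Realize v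

/-- The Gödel number of a term whose variables are bound variables. -/
def codeTerm {n : ℕ} : Lang.Term (Empty ⊕ Fin n) → ℕ
  | Term.var (Sum.inr i) => Nat.pair 0 i
  | Term.func Func.negOne _ => Nat.pair 1 0
  | Term.func Func.zero _ => Nat.pair 2 0
  | Term.func Func.one _ => Nat.pair 3 0
  | Term.func Func.inv ts => Nat.pair 4 (codeTerm (ts 0))
  | Term.func Func.mul ts => Nat.pair 5 (Nat.pair (codeTerm (ts 0)) (codeTerm (ts 1)))

/-- The Gödel number of a formula without free variables other than `&0, …, &(n-1)`. -/
def code : {n : ℕ} → Lang.BoundedFormula Empty n → ℕ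
  | _, BoundedFormula.falsum => Nat.pair 0 0
  | _, BoundedFormula.equal s t => Nat.pair 1 (Nat.pair (codeTerm s) (codeTerm t))
  | _, BoundedFormula.rel Rel.lt ts => Nat.pair 2 (Nat.pair (codeTerm (ts 0)) (codeTerm (ts 1)))
  | _, BoundedFormula.imp φ ψ => Nat.pair 3 (Nat.pair (code φ) (code ψ))
  | _, BoundedFormula.all φ => Nat.pair 4 (code φ)

/-- A set of sentences is decidable if the set of the Gödel numbers of its members is
computable. -/
def DecidableTheory (T : Lang.Theory) : Prop :=
  ComputablePred fun k : ℕ => ∃ φ : Lang.Sentence, φ ∈ T ∧ code φ = k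

end OrdMul

/-! A nonzero real is a sign together with the logarithm of its absolute value; in these coordinates
multiplication multiplies signs and adds logarithms. The same works in every model of the axioms:
the positive elements form an ordered abelian group, which the root axioms make divisible
(`SignedGroup.exists_eq_nsmul`) and the element above `1` makes nontrivial. A term becomes a product
of signs together with an integer linear form in the logarithms, so the matter is one of nontrivial
divisible ordered abelian groups with signs attached (`Coordinates`).

The core is a back-and-forth argument with explicit bounds. Two tuples are similar up to `A` if
their signs agree and integer linear forms with coefficients of absolute value at most `A` are
positive at the same time. A further element `x` of one side matters only through its position among
finitely many thresholds, the points where the forms in `g` and `x` vanish. Two thresholds are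
compared by a form with coefficients up to `2 * A ^ 2`, so tuples similar up to that bound have
their thresholds in the same order, and `x` has a counterpart: a threshold, the midpoint of two
neighbouring ones, or a point beyond an extreme one (`exists_extension`). By induction on formulas,
tuples that are similar up to a bound computed from the code of a formula agree on it
(`sat_iff_of_similar`).

This yields all the claims. Empty tuples are always similar, so every model agrees with the reals on
sentences (`realize_sentence_iff`). Similarity of real tuples is agreement on finitely many
quantifier-free conditions, and a predicate determined by finitely many such conditions is a Boolean
combination of them (`QFDefinable.of_finite`, `hasQE_real`). Finally, the counterpart is an explicit
integer combination with bounded coefficients. Hence the logarithms may be taken in the integers, if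
those chosen early are sufficiently divisible, and every quantifier then ranges over a finite
computable set (`rich_intRange`, `real_models_iff_sat`). A primitive recursive evaluator decides
truth there (`exists_mem_completeTheory_iff`). -/

namespace OrdMul

/-! ### Integer linear forms and thresholds. -/

section LinForm

variable {G : Type} [AddCommGroup G]

/-- The integer linear form with coefficients `c`, evaluated at `g`. -/
def linForm {n : ℕ} (c : Fin n → ℤ) (g : Fin n → G) : G := ∑ i, c i • g i

lemma linForm_smul_left {n : ℕ} (r : ℤ) (c : Fin n → ℤ) (g : Fin n → G) :
    linForm (fun i => r * c i) g = r • linForm c g := by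
  simp only [linForm, Finset.smul_sum, mul_smul]

lemma linForm_smul_right {n : ℕ} (r : ℤ) (c : Fin n → ℤ) (g : Fin n → G) :
    linForm c (fun i => r • g i) = r • linForm c g := by
  simp only [linForm, Finset.smul_sum, smul_comm r]

lemma linForm_add {n : ℕ} (c d : Fin n → ℤ) (g : Fin n → G) :
    linForm (fun i => c i + d i) g = linForm c g + linForm d g := by
  simp only [linForm, add_smul, Finset.sum_add_distrib]

lemma linForm_sub {n : ℕ} (c d : Fin n → ℤ) (g : Fin n → G) :
    linForm (fun i => c i - d i) g = linForm c g - linForm d g := by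
  simp only [linForm, sub_smul, Finset.sum_sub_distrib]

lemma linForm_neg {n : ℕ} (c : Fin n → ℤ) (g : Fin n → G) :
    linForm (fun i => - c i) g = - linForm c g := by
  simp only [linForm, neg_smul, Finset.sum_neg_distrib]

end LinForm

/-- The position of a point relative to finitely many thresholds. -/
lemma threshold_cases {P G : Type} [LinearOrder G] (s : Finset P) (hs : s.Nonempty) (τ : P → G) (X : G) :
    (∃ p ∈ s, τ p = X) ∨
    (∃ p ∈ s, ∃ q ∈ s, τ p < X ∧ X < τ q ∧ ∀ r ∈ s, τ r ≤ τ p ∨ τ q ≤ τ r) ∨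
    (∃ p ∈ s, τ p < X ∧ ∀ r ∈ s, τ r ≤ τ p) ∨
    (∃ q ∈ s, X < τ q ∧ ∀ r ∈ s, τ q ≤ τ r) := by
  classical
  by_cases h1 : ∃ p ∈ s, τ p = X
  · exact Or.inl h1
  push Not at h1
  right
  by_cases hlo : (s.filter (fun p => τ p < X)).Nonempty
  · obtain ⟨p, hp, hpm⟩ := Finset.exists_max_image _ τ hlo
    rw [Finset.mem_filter] at hp
    by_cases hhi : (s.filter (fun p => X < τ p)).Nonempty
    · obtain ⟨q, hq, hqm⟩ := Finset.exists_min_image _ τ hhi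
      rw [Finset.mem_filter] at hq
      refine Or.inl ⟨p, hp.1, q, hq.1, hp.2, hq.2, fun r hr => ?_⟩
      rcases lt_or_gt_of_ne (h1 r hr) with h | h
      · exact Or.inl (hpm r (Finset.mem_filter.2 ⟨hr, h⟩))
      · exact Or.inr (hqm r (Finset.mem_filter.2 ⟨hr, h⟩))
    · refine Or.inr (Or.inl ⟨p, hp.1, hp.2, fun r hr => ?_⟩)
      rcases lt_or_gt_of_ne (h1 r hr) with h | h
      · exact hpm r (Finset.mem_filter.2 ⟨hr, h⟩)
      · exact absurd ⟨r, Finset.mem_filter.2 ⟨hr, h⟩⟩ hhi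
  · have hall : ∀ r ∈ s, X < τ r := fun r hr =>
      (lt_or_gt_of_ne (h1 r hr)).resolve_left fun h => hlo ⟨r, Finset.mem_filter.2 ⟨hr, h⟩⟩
    obtain ⟨q, hq, hqm⟩ := Finset.exists_min_image _ τ hs
    exact Or.inr (Or.inr ⟨q, hq, hall q hq, hqm⟩)

/-! ### The one-step extension property in ordered abelian groups. -/

section Extension

variable {G G' : Type} [AddCommGroup G] [LinearOrder G] [IsOrderedAddMonoid G]
  [AddCommGroup G'] [LinearOrder G'] [IsOrderedAddMonoid G']

/-- For `k * m = L`, the bound that `linForm c g + m • x > 0` imposes on `L • x`. -/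
lemma linForm_add_pos_iff {n : ℕ} {L m k : ℤ} (hk : 0 < k) (hkm : k * m = L)
    (c : Fin n → ℤ) (g : Fin n → G) (x : G) :
    0 < linForm c g + m • x ↔ -(k • linForm c g) < L • x := by
  rw [← zsmul_lt_zsmul_iff_right hk, smul_zero, smul_add, smul_smul, hkm, neg_lt_iff_pos_add']

lemma linForm_sub_pos_iff {n : ℕ} {L m k : ℤ} (hk : 0 < k) (hkm : k * m = L)
    (c : Fin n → ℤ) (g : Fin n → G) (x : G) :
    0 < linForm (fun i => - c i) g + (-m) • x ↔ L • x < -(k • linForm c g) := by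
  rw [linForm_neg, ← zsmul_lt_zsmul_iff_right hk, smul_zero, smul_add, smul_smul, mul_neg, hkm,
    neg_smul, smul_neg, ← sub_eq_add_neg, sub_pos]

/-- Two of these bounds are compared by a linear form with larger coefficients. -/
lemma neg_linForm_lt_iff {n : ℕ} {L m k m' k' : ℤ} (hk : 0 < k) (hm : 0 < m) (hm' : 0 < m')
    (hkm : k * m = L) (hkm' : k' * m' = L) (c c' : Fin n → ℤ) (g : Fin n → G) :
    -(k • linForm c g) < -(k' • linForm c' g) ↔
      0 < linForm (fun i => m' * c i - m * c' i) g := by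
  have hL : 0 < L := hkm ▸ mul_pos hk hm
  rw [neg_lt_neg_iff, ← zsmul_lt_zsmul_iff_right (mul_pos hm hm'), smul_smul, smul_smul,
    show m * m' * k' = L * m by rw [← hkm']; ring, show m * m' * k = L * m' by rw [← hkm]; ring,
    mul_smul, mul_smul, zsmul_lt_zsmul_iff_right hL, linForm_sub, linForm_smul_left,
    linForm_smul_left, sub_pos]

/-- The midpoint is given through `2 • y`, so that no divisibility of the group is needed. -/
lemma lt_of_two_smul_eq_add {a b y : G} (hab : a < b) (h : (2 : ℤ) • y = a + b) :
    a < y ∧ y < b := by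
  rw [two_zsmul] at h
  constructor
  · by_contra! hy
    exact absurd h (ne_of_lt (lt_of_le_of_lt (add_le_add hy hy) (add_lt_add_right hab a)))
  · by_contra! hy
    exact absurd h (ne_of_gt (lt_of_lt_of_le (add_lt_add_left hab b) (add_le_add hy hy)))

open Nat in
/-- The one-step extension property: if all linear forms with coefficients up to `2 * A ^ 2` have
the same sign at `g` and at `(2 * A !) • h`, then every `x` has a counterpart, in the lattice
spanned by `h` and a positive element `u`, for the linear forms with coefficients up to `A`. -/
theorem exists_extension {n : ℕ} {A : ℕ} (hA : 1 ≤ A) (g : Fin n → G) (h : Fin n → G') {u : G'}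
    (hu : 0 < u)
    (hR : ∀ c : Fin n → ℤ, (∀ i, |c i| ≤ 2 * (A : ℤ) ^ 2) →
      (0 < linForm c g ↔ 0 < linForm c (fun i => (2 * (A ! : ℤ)) • h i))) (x : G) :
    ∃ (a : Fin n → ℤ) (ε : ℤ), (∀ i, |a i| ≤ 2 * (A ! : ℤ) * A) ∧ |ε| ≤ 1 ∧
      ∀ (c : Fin n → ℤ) (m : ℤ), (∀ i, |c i| ≤ A) → |m| ≤ A →
        (0 < linForm c g + m • x ↔
          0 < linForm c (fun i => (2 * (A ! : ℤ)) • h i) + m • (linForm a h + ε • u)) := by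
  classical
  -- Every `m` with `1 ≤ m ≤ A` divides `A !`, so all conditions on the elements `m • x` can be
  -- scaled to conditions on the single element `L • x`.
  set L : ℤ := (A ! : ℤ) with hLdef
  have hL : 0 < L := by rw [hLdef]; exact_mod_cast A.factorial_pos
  set g' : Fin n → G' := fun i => (2 * L) • h i with hg'
  have hg'c : ∀ c : Fin n → ℤ, linForm c g' = (2 * L) • linForm c h := fun c =>
    linForm_smul_right _ _ _
  -- The pair `(c, m)` stands for the form `linForm c g + m • x` with positive `m`; below, `τ (c,
  -- m)` is the value of `L • x` at which it vanishes, and `τ'` is its analogue for `g'`.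
  let P : Finset ((Fin n → ℤ) × ℤ) :=
    (Fintype.piFinset fun _ => Finset.Icc (-(A : ℤ)) A) ×ˢ Finset.Icc 1 (A : ℤ)
  have hP : ∀ p, p ∈ P ↔ (∀ i, |p.1 i| ≤ A) ∧ 1 ≤ p.2 ∧ p.2 ≤ A := by
    intro p
    simp only [P, Finset.mem_product, Fintype.mem_piFinset, Finset.mem_Icc, abs_le]
  let k : (Fin n → ℤ) × ℤ → ℤ := fun p => L / p.2
  have hk : ∀ p ∈ P, k p * p.2 = L ∧ 0 < k p ∧ k p ≤ L := by
    intro p hp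
    obtain ⟨-, h1, h2⟩ := (hP p).1 hp
    have hd : p.2 ∣ L := by
      obtain ⟨m, hm⟩ := Int.eq_ofNat_of_zero_le (by lia : 0 ≤ p.2)
      rw [hm] at h1 h2 ⊢
      rw [hLdef]
      exact_mod_cast Nat.dvd_factorial (by lia) (by lia)
    have hkm : k p * p.2 = L := Int.ediv_mul_cancel hd
    refine ⟨hkm, pos_of_mul_pos_left (hkm ▸ hL) (by lia), Int.ediv_le_self _ hL.le⟩
  let τ : (Fin n → ℤ) × ℤ → G := fun p => -(k p • linForm p.1 g)
  let τ' : (Fin n → ℤ) × ℤ → G' := fun p => -(k p • linForm p.1 g')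
  have hττ' : ∀ p ∈ P, ∀ q ∈ P, (τ p < τ q ↔ τ' p < τ' q) := by
    intro p hp q hq
    obtain ⟨hkp, hkp0, -⟩ := hk p hp
    obtain ⟨hkq, -, -⟩ := hk q hq
    obtain ⟨hp1, hp2, hp3⟩ := (hP p).1 hp
    obtain ⟨hq1, hq2, hq3⟩ := (hP q).1 hq
    simp only [τ, τ']
    rw [neg_linForm_lt_iff hkp0 (by lia) (by lia) hkp hkq,
      neg_linForm_lt_iff hkp0 (by lia) (by lia) hkp hkq]
    -- The thresholds of `(c, m)` and `(c', m')` are compared by the form `m' * c - m * c'`; this is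
    -- the origin of the bound `2 * A ^ 2`.
    refine hR _ fun i => ?_
    have e1 : |q.2 * p.1 i| ≤ A * A := by
      rw [abs_mul, abs_of_pos (by lia : 0 < q.2)]
      exact mul_le_mul hq3 (hp1 i) (abs_nonneg _) (by lia)
    have e2 : |p.2 * q.1 i| ≤ A * A := by
      rw [abs_mul, abs_of_pos (by lia : 0 < p.2)]
      exact mul_le_mul hp3 (hq1 i) (abs_nonneg _) (by lia)
    calc _ ≤ |q.2 * p.1 i| + |p.2 * q.1 i| := abs_sub _ _
      _ ≤ A * A + A * A := add_le_add e1 e2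
      _ = 2 * (A : ℤ) ^ 2 := by ring
  have hττ'le : ∀ p ∈ P, ∀ q ∈ P, (τ p ≤ τ q ↔ τ' p ≤ τ' q) := fun p hp q hq => by
    rw [← not_lt, ← not_lt, hττ' q hq p hp]
  have hPne : P.Nonempty := ⟨(0, 1), by rw [hP]; exact ⟨fun i => by simp, by simp, by simpa⟩⟩
  have hka : ∀ p ∈ P, ∀ i, |k p * p.1 i| ≤ L * A := by
    intro p hp i
    obtain ⟨-, hk0, hk1⟩ := hk p hp
    rw [abs_mul, abs_of_pos hk0]
    exact mul_le_mul hk1 (((hP p).1 hp).1 i) (abs_nonneg _) hL.le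
  -- the counterpart need only have the right position relative to the thresholds
  suffices H : ∃ (a : Fin n → ℤ) (ε : ℤ), (∀ i, |a i| ≤ 2 * L * A) ∧ |ε| ≤ 1 ∧
      ∀ r ∈ P, (τ r < L • x ↔ τ' r < L • (linForm a h + ε • u)) ∧
        (L • x < τ r ↔ L • (linForm a h + ε • u) < τ' r) by
    obtain ⟨a, ε, ha, hε, H⟩ := H
    refine ⟨a, ε, ha, hε, fun c m hc hm => ?_⟩
    rcases lt_trichotomy m 0 with hm0 | hm0 | hm0
    -- With negative `m` the condition bounds `L • x` from above, by the threshold of the negated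
    -- form.
    · have hp : ((fun i => - c i, -m) : (Fin n → ℤ) × ℤ) ∈ P := by
        rw [hP]
        exact ⟨fun i => by simpa using hc i, by lia, by rw [abs_le] at hm; simp only; lia⟩
      obtain ⟨hkm, hk0, -⟩ := hk _ hp
      have key := (H _ hp).2
      simp only [τ, τ'] at key
      rw [← linForm_sub_pos_iff hk0 hkm, ← linForm_sub_pos_iff hk0 hkm] at key
      simpa using key
    · subst hm0
      simp only [zero_smul, add_zero]
      refine hR c fun i => (hc i).trans ?_
      have : (1 : ℤ) ≤ A := by exact_mod_cast hA
      nlinarith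
    · have hp : ((c, m) : (Fin n → ℤ) × ℤ) ∈ P := by
        rw [hP]
        exact ⟨hc, by lia, by rw [abs_le] at hm; simp only; lia⟩
      obtain ⟨hkm, hk0, -⟩ := hk _ hp
      rw [linForm_add_pos_iff hk0 hkm, linForm_add_pos_iff hk0 hkm]
      exact (H _ hp).1
  have hb : ∀ p ∈ P, ∀ i, |(-2 * k p) * p.1 i| ≤ 2 * L * A := by
    intro p hp i
    have := hka p hp i
    rw [mul_assoc, abs_mul, abs_neg, abs_two]
    linarith
  -- As `g'` is `(2 * L) • h`, the threshold `τ' p` can be divided by `L` within the integer span of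
  -- `h`; the quotient has the coefficients `-2 * k p * p.1 i`.
  have hval : ∀ (p : (Fin n → ℤ) × ℤ) (ε : ℤ),
      L • (linForm (fun i => (-2 * k p) * p.1 i) h + ε • u) = τ' p + (L * ε) • u := by
    intro p ε
    simp only [τ', hg'c, linForm_smul_left]
    module
  have hLu : 0 < L • u := zsmul_pos hu hL
  rcases threshold_cases P hPne τ (L • x) with
    ⟨p, hp, he⟩ | ⟨p, hp, q, hq, h1, h2, h3⟩ | ⟨p, hp, h1, h2⟩ | ⟨q, hq, h1, h2⟩
  · refine ⟨fun i => (-2 * k p) * p.1 i, 0, hb p hp, by simp, fun r hr => ?_⟩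
    rw [hval, mul_zero, zero_smul, add_zero, ← he]
    exact ⟨hττ' r hr p hp, hττ' p hp r hr⟩
  -- The witness is `(τ' p + τ' q) / (2 * L)`; the factor `2` in `g' = (2 * L) • h` keeps its
  -- coefficients integral.
  · refine ⟨fun i => -(k p * p.1 i + k q * q.1 i), 0, fun i => ?_, by simp, fun r hr => ?_⟩
    · rw [abs_neg]
      have := abs_add_le (k p * p.1 i) (k q * q.1 i)
      linarith [hka p hp i, hka q hq i]
    · have hpq : τ' p < τ' q := (hττ' p hp q hq).1 (h1.trans h2)
      obtain ⟨h4, h5⟩ := lt_of_two_smul_eq_add (y := L • (linForm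
        (fun i => -(k p * p.1 i + k q * q.1 i)) h + (0 : ℤ) • u)) hpq (by
          simp only [τ', hg'c, linForm_neg, linForm_add, linForm_smul_left]
          module)
      rcases h3 r hr with h6 | h6
      · have h7 := (hττ'le r hr p hp).1 h6
        exact ⟨iff_of_true (h6.trans_lt h1) (h7.trans_lt h4),
          iff_of_false (h6.trans_lt h1).not_gt (h7.trans_lt h4).not_gt⟩
      · have h7 := (hττ'le q hq r hr).1 h6
        exact ⟨iff_of_false (h2.trans_le h6).not_gt (h5.trans_le h7).not_gt,
          iff_of_true (h2.trans_le h6) (h5.trans_le h7)⟩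
  -- Beyond the largest threshold a step by the positive element `u` suffices.
  · refine ⟨fun i => (-2 * k p) * p.1 i, 1, hb p hp, by simp, fun r hr => ?_⟩
    rw [hval, mul_one]
    have h6 := h2 r hr
    have h4 : τ' r < τ' p + L • u :=
      lt_of_le_of_lt ((hττ'le r hr p hp).1 h6) (lt_add_of_pos_right _ hLu)
    exact ⟨iff_of_true (h6.trans_lt h1) h4, iff_of_false (h6.trans_lt h1).not_gt h4.not_gt⟩
  · refine ⟨fun i => (-2 * k q) * q.1 i, -1, hb q hq, by simp, fun r hr => ?_⟩
    rw [hval, mul_neg_one, neg_smul]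
    have h6 := h2 r hr
    have h4 : τ' q + -(L • u) < τ' r :=
      lt_of_lt_of_le (add_lt_of_neg_right _ (neg_lt_zero.2 hLu)) ((hττ'le q hq r hr).1 h6)
    exact ⟨iff_of_false (h1.trans_le h6).not_gt h4.not_gt, iff_of_true (h1.trans_le h6) h4⟩

end Extension

end OrdMul

namespace OrdMul

/-! ### Signs and exponents of terms. -/

section Terms

variable {n : ℕ}

/-- The sign of a term, given the signs of the variables. -/
def termSign : Lang.Term (Empty ⊕ Fin n) → (Fin n → SignType) → SignType
  | Term.var (Sum.inr i), s => s i
  | Term.func Func.negOne _, _ => -1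
  | Term.func Func.zero _, _ => 0
  | Term.func Func.one _, _ => 1
  | Term.func Func.inv ts, s => termSign (ts 0) s
  | Term.func Func.mul ts, s => termSign (ts 0) s * termSign (ts 1) s

/-- The exponent of a variable in a term. -/
def coef : Lang.Term (Empty ⊕ Fin n) → Fin n → ℤ
  | Term.var (Sum.inr i), j => if j = i then 1 else 0
  | Term.func Func.negOne _, _ => 0
  | Term.func Func.zero _, _ => 0
  | Term.func Func.one _, _ => 0
  | Term.func Func.inv ts, j => - coef (ts 0) j
  | Term.func Func.mul ts, j => coef (ts 0) j + coef (ts 1) j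

/-- Codes dominate exponents because `Nat.pair a b` is at least `a + b`. The summand `1` is there
for the variable `&0`, which has code `0` and exponent `1`. -/
lemma abs_coef_le (j : Fin n) : ∀ t : Lang.Term (Empty ⊕ Fin n), |coef t j| ≤ codeTerm t + 1
  | Term.var (Sum.inr i) => by
    rw [coef]
    split_ifs <;> simp; positivity
  | Term.func Func.negOne _ => by rw [coef, abs_zero]; positivity
  | Term.func Func.zero _ => by rw [coef, abs_zero]; positivity
  | Term.func Func.one _ => by rw [coef, abs_zero]; positivity
  | Term.func Func.inv ts => by
    have h := abs_coef_le j (ts 0)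
    have h' := Nat.add_le_pair 4 (codeTerm (ts 0))
    rw [coef, codeTerm, abs_neg]
    lia
  | Term.func Func.mul ts => by
    have h := abs_coef_le j (ts 0)
    have h1 := abs_coef_le j (ts 1)
    have h2 := Nat.add_le_pair 5 (Nat.pair (codeTerm (ts 0)) (codeTerm (ts 1)))
    have h3 := Nat.add_le_pair (codeTerm (ts 0)) (codeTerm (ts 1))
    have h4 := abs_add_le (coef (ts 0) j) (coef (ts 1) j)
    rw [coef, codeTerm]
    lia

end Terms

lemma forall_snoc_mem {G : Type} {D : ℕ → Set G} {n : ℕ} {v : Fin n → SignType × G}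
    (hv : ∀ i : Fin n, (v i).2 ∈ D i) (s : SignType) {x : G} (hx : x ∈ D n) (i : Fin (n + 1)) :
    (Fin.snoc (α := fun _ => SignType × G) v (s, x) i).2 ∈ D i := by
  refine Fin.lastCases ?_ (fun i => ?_) i
  · simpa using hx
  · simpa using hv i

/-! ### Satisfaction by signs and logarithms, and the back-and-forth argument. -/

section Sat

variable {G : Type} [AddCommGroup G]

/-- The value of a term, as a pair of a sign and the logarithm of an absolute value. The second
component carries no information if the sign is zero. -/
def termVal {n : ℕ} (t : Lang.Term (Empty ⊕ Fin n)) (v : Fin n → SignType × G) : SignType × G :=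
  (termSign t fun i => (v i).1, linForm (coef t) fun i => (v i).2)

/-- Two pairs of a sign and a logarithm represent the same element. -/
def ValEq (x y : SignType × G) : Prop := x.1 = y.1 ∧ (x.1 = 0 ∨ x.2 = y.2)

/-- The order on pairs of a sign and a logarithm. -/
def ValLT [LinearOrder G] (x y : SignType × G) : Prop :=
  x.1 < y.1 ∨ (x.1 = y.1 ∧ ((x.1 = 1 ∧ x.2 < y.2) ∨ (x.1 = -1 ∧ y.2 < x.2)))

/-- Satisfaction of a formula in the structure of signs and logarithms, where the logarithm of the
`n`-th variable ranges over the set `D n`. -/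
def Sat [LinearOrder G] (D : ℕ → Set G) :
    {n : ℕ} → Lang.BoundedFormula Empty n → (Fin n → SignType × G) → Prop
  | _, BoundedFormula.falsum, _ => False
  | _, BoundedFormula.equal s t, v => ValEq (termVal s v) (termVal t v)
  | _, BoundedFormula.rel Rel.lt ts, v => ValLT (termVal (ts 0) v) (termVal (ts 1) v)
  | _, BoundedFormula.imp φ ψ, v => Sat D φ v → Sat D ψ v
  | n, BoundedFormula.all φ, v => ∀ s : SignType, ∀ g ∈ D n,
      Sat D φ (Fin.snoc (α := fun _ => SignType × G) v (s, g))

lemma linForm_snoc {n : ℕ} (c : Fin (n + 1) → ℤ) (v : Fin n → SignType × G) (x : SignType × G) :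
    linForm c (fun i => (Fin.snoc (α := fun _ => SignType × G) v x i).2) =
      linForm (fun i => c i.castSucc) (fun i => (v i).2) + c (Fin.last n) • x.2 := by
  simp [linForm, Fin.sum_univ_castSucc]

variable [LinearOrder G] {G' : Type} [AddCommGroup G'] [LinearOrder G']

/-- The tuples have the same signs, and integer linear forms with coefficients up to `A` have the
same sign at the logarithms. -/
def Similar {n : ℕ} (A : ℕ) (v : Fin n → SignType × G) (v' : Fin n → SignType × G') : Prop :=
  (∀ i, (v i).1 = (v' i).1) ∧ ∀ c : Fin n → ℤ, (∀ i, |c i| ≤ A) →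
    (0 < linForm c (fun i => (v i).2) ↔ 0 < linForm c (fun i => (v' i).2))

lemma Similar.symm {n A : ℕ} {v : Fin n → SignType × G} {v' : Fin n → SignType × G'}
    (h : Similar A v v') : Similar A v' v :=
  ⟨fun i => (h.1 i).symm, fun c hc => (h.2 c hc).symm⟩

section

variable [IsOrderedAddMonoid G] [IsOrderedAddMonoid G']

/-- The comparison is the sign of the difference of the two forms, whose coefficients `abs_coef_le`
bounds by the sum of the codes plus `2`. -/
lemma Similar.termVal_lt_iff {n A : ℕ} {v : Fin n → SignType × G} {v' : Fin n → SignType × G'}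
    (h : Similar A v v') (s t : Lang.Term (Empty ⊕ Fin n)) (hA : codeTerm s + codeTerm t + 2 ≤ A) :
    (termVal s v).2 < (termVal t v).2 ↔ (termVal s v').2 < (termVal t v').2 := by
  simp only [termVal]
  rw [← sub_pos, ← linForm_sub, ← sub_pos (b := linForm (coef s) _), ← linForm_sub]
  refine h.2 _ fun i => ?_
  have h1 := abs_coef_le i s
  have h2 := abs_coef_le i t
  have h3 := abs_sub (coef t i) (coef s i)
  lia

lemma Similar.valLT_iff {n A : ℕ} {v : Fin n → SignType × G} {v' : Fin n → SignType × G'}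
    (h : Similar A v v') (s t : Lang.Term (Empty ⊕ Fin n)) (hA : codeTerm s + codeTerm t + 2 ≤ A) :
    ValLT (termVal s v) (termVal t v) ↔ ValLT (termVal s v') (termVal t v') := by
  have h0 : (fun i => (v i).1) = fun i => (v' i).1 := funext h.1
  have h1 := h.termVal_lt_iff s t hA
  have h2 := h.termVal_lt_iff t s (by lia)
  simp only [ValLT, h1, h2]
  simp only [termVal, h0]

lemma Similar.valEq_iff {n A : ℕ} {v : Fin n → SignType × G} {v' : Fin n → SignType × G'}
    (h : Similar A v v') (s t : Lang.Term (Empty ⊕ Fin n)) (hA : codeTerm s + codeTerm t + 2 ≤ A) :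
    ValEq (termVal s v) (termVal t v) ↔ ValEq (termVal s v') (termVal t v') := by
  have h0 : (fun i => (v i).1) = fun i => (v' i).1 := funext h.1
  have h1 := h.termVal_lt_iff s t hA
  have h2 := h.termVal_lt_iff t s (by lia)
  -- Equality is the failure of both strict inequalities, so similarity need only speak of
  -- positivity.
  have h3 : (termVal s v).2 = (termVal t v).2 ↔ (termVal s v').2 = (termVal t v').2 := by
    rw [← not_iff_not, ← ne_eq, ← ne_eq, lt_or_lt_iff_ne.symm, lt_or_lt_iff_ne.symm, h1, h2]
  simp only [ValEq, h3]
  simp only [termVal, h0]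

end

open Nat in
/-- The quantifier ranges `D` are rich enough for the extension property at every level below
`Q`, for linear forms bounded by `β`. -/
def Rich (D : ℕ → Set G) (β : ℕ → ℕ) (Q : ℕ) : Prop :=
  ∀ n < Q, ∀ g : Fin n → G, (∀ i : Fin n, g i ∈ D i) → ∃ (h : Fin n → G) (u : G), 0 < u ∧
    (∀ i, g i = (2 * ((β (n + 1))! : ℤ)) • h i) ∧
    ∀ (a : Fin n → ℤ) (ε : ℤ), (∀ i, |a i| ≤ 2 * ((β (n + 1))! : ℤ) * β (n + 1)) → |ε| ≤ 1 →
      linForm a h + ε • u ∈ D n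

variable [IsOrderedAddMonoid G] [IsOrderedAddMonoid G']

/-- Richness supplies the divided tuple and the positive element for `exists_extension`, and it puts
the resulting logarithm into the range of the quantifier. The sign of the new element is copied. -/
lemma Similar.exists_snoc {D : ℕ → Set G'} {β : ℕ → ℕ} {Q n : ℕ} (hD : Rich D β Q)
    (hn : n < Q) (hβ : 2 * β (n + 1) ^ 2 ≤ β n) (hβ1 : 1 ≤ β (n + 1))
    {v : Fin n → SignType × G} {v' : Fin n → SignType × G'} (hv' : ∀ i : Fin n, (v' i).2 ∈ D i)
    (h : Similar (β n) v v') (s : SignType) (x : G) :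
    ∃ x' ∈ D n, Similar (β (n + 1)) (Fin.snoc (α := fun _ => SignType × G) v (s, x))
      (Fin.snoc (α := fun _ => SignType × G') v' (s, x')) := by
  obtain ⟨w, u, hu, hw, hmem⟩ := hD n hn _ hv'
  have hw' : (fun i => (v' i).2) = fun i => (2 * (Nat.factorial (β (n + 1)) : ℤ)) • w i :=
    funext hw
  obtain ⟨a, ε, ha, hε, key⟩ := exists_extension hβ1 (fun i => (v i).2) w hu (fun c hc => by
    rw [← hw']
    exact h.2 c fun i => (hc i).trans (by exact_mod_cast hβ)) x
  refine ⟨_, hmem a ε ha hε, ?_, fun c hc => ?_⟩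
  · intro i
    refine Fin.lastCases ?_ (fun i => ?_) i
    · simp
    · simpa using h.1 i
  · rw [linForm_snoc, linForm_snoc, hw']
    exact key _ _ (fun i => hc _) (hc _)

/-- Back and forth: similar tuples satisfy the same formulas. -/
theorem sat_iff_of_similar {D : ℕ → Set G} {D' : ℕ → Set G'} {β : ℕ → ℕ} {Q K : ℕ}
    (hD : Rich D β Q) (hD' : Rich D' β Q) (hβ : ∀ n < Q, 2 * β (n + 1) ^ 2 ≤ β n)
    (hK : ∀ n ≤ Q, K ≤ β n) : ∀ {n : ℕ} (φ : Lang.BoundedFormula Empty n)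
    (v : Fin n → SignType × G) (v' : Fin n → SignType × G'),
    (∀ i : Fin n, (v i).2 ∈ D i) → (∀ i : Fin n, (v' i).2 ∈ D' i) → code φ + 2 ≤ K → n + code φ ≤ Q →
    Similar (β n) v v' → (Sat D φ v ↔ Sat D' φ v')
  | _, BoundedFormula.falsum, v, v', _, _, _, _, _ => by simp only [Sat]
  | n, BoundedFormula.equal s t, v, v', _, _, h1, h2, h => by
    simp only [Sat]
    refine h.valEq_iff s t ?_
    have h3 := Nat.add_le_pair 1 (Nat.pair (codeTerm s) (codeTerm t))
    have h4 := Nat.add_le_pair (codeTerm s) (codeTerm t)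
    have h5 := hK n (by lia)
    rw [code] at h1
    lia
  | n, BoundedFormula.rel Rel.lt ts, v, v', _, _, h1, h2, h => by
    simp only [Sat]
    refine h.valLT_iff (ts 0) (ts 1) ?_
    have h3 := Nat.add_le_pair 2 (Nat.pair (codeTerm (ts 0)) (codeTerm (ts 1)))
    have h4 := Nat.add_le_pair (codeTerm (ts 0)) (codeTerm (ts 1))
    have h5 := hK n (by lia)
    rw [code] at h1
    lia
  | n, BoundedFormula.imp φ ψ, v, v', hv, hv', h1, h2, h => by
    simp only [Sat]
    have h3 := Nat.add_le_pair 3 (Nat.pair (code φ) (code ψ))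
    have h4 := Nat.add_le_pair (code φ) (code ψ)
    rw [code] at h1 h2
    rw [sat_iff_of_similar hD hD' hβ hK φ v v' hv hv' (by lia) (by lia) h,
      sat_iff_of_similar hD hD' hβ hK ψ v v' hv hv' (by lia) (by lia) h]
  | n, BoundedFormula.all φ, v, v', hv, hv', h1, h2, h => by
    simp only [Sat]
    have h3 := Nat.add_le_pair 4 (code φ)
    rw [code] at h1 h2
    -- The code of a universal formula exceeds that of its body by at least `4`, so the budget `n +
    -- code φ ≤ Q` survives the passage to `n + 1` variables.
    have hn : n < Q := by lia
    have hK1 := hK (n + 1) hn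
    constructor
    · intro H s x' hx'
      obtain ⟨x, hx, hs⟩ := h.symm.exists_snoc hD hn (hβ n hn) (by lia) hv s x'
      exact (sat_iff_of_similar hD hD' hβ hK φ _ _ (forall_snoc_mem hv s hx)
        (forall_snoc_mem hv' s hx') (by lia) (by lia) hs.symm).1 (H s x hx)
    · intro H s x hx
      obtain ⟨x', hx', hs⟩ := h.exists_snoc hD' hn (hβ n hn) (by lia) hv' s x
      exact (sat_iff_of_similar hD hD' hβ hK φ _ _ (forall_snoc_mem hv s hx)
        (forall_snoc_mem hv' s hx') (by lia) (by lia) hs).2 (H s x' hx')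

end Sat

/-! ### Bounds for the coefficients. -/

section Bounds

/-- Bounds for linear forms: `K` at the innermost level, squared and doubled at each quantifier. -/
def coefBound (K : ℕ) : ℕ → ℕ
  | 0 => K
  | r + 1 => 2 * coefBound K r ^ 2

lemma coefBound_sub {K Q n : ℕ} (hn : n < Q) :
    2 * coefBound K (Q - (n + 1)) ^ 2 = coefBound K (Q - n) := by
  rw [show Q - n = (Q - (n + 1)) + 1 by lia, coefBound]

lemma le_coefBound (K r : ℕ) : K ≤ coefBound K r := by
  induction r with
  | zero => exact le_rfl
  | succ r ih => rw [coefBound]; nlinarith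

lemma coefBound_mono (K : ℕ) : Monotone (coefBound K) :=
  monotone_nat_of_le_succ fun r => by rw [coefBound]; nlinarith

/-- A nontrivial divisible group is rich, with unbounded quantifiers. -/
lemma rich_univ {G : Type} [AddCommGroup G] [LinearOrder G] {u : G} (hu : 0 < u)
    (hdiv : ∀ (m : ℕ) (g : G), 1 ≤ m → ∃ h : G, g = m • h) (β : ℕ → ℕ) (Q : ℕ) :
    Rich (fun _ => (Set.univ : Set G)) β Q := by
  intro n _ g _
  have := fun i => hdiv (2 * Nat.factorial (β (n + 1))) (g i)
    (by have := (β (n + 1)).factorial_pos; lia)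
  choose h hh using this
  refine ⟨h, u, hu, fun i => ?_, fun _ _ _ _ => Set.mem_univ _⟩
  rw [hh i, ← natCast_zsmul]
  push_cast
  rfl

end Bounds

end OrdMul

namespace OrdMul

/-! ### Coordinates for structures, and the coordinates of the reals. -/

section Values

variable {G : Type}

lemma ValEq.refl (x : SignType × G) : ValEq x x := ⟨rfl, Or.inr rfl⟩

lemma ValEq.symm {x y : SignType × G} (h : ValEq x y) : ValEq y x :=
  ⟨h.1.symm, h.2.imp (fun h0 => h.1 ▸ h0) Eq.symm⟩

lemma ValEq.trans {x y z : SignType × G} (h : ValEq x y) (h' : ValEq y z) : ValEq x z := by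
  refine ⟨h.1.trans h'.1, ?_⟩
  rcases h.2 with h0 | h0
  · exact Or.inl h0
  · exact h'.2.imp (fun h1 => h.1.trans h1) fun h1 => h0.trans h1

lemma ValEq.congr {x x' y y' : SignType × G} (h : ValEq x x') (h' : ValEq y y') :
    ValEq x y ↔ ValEq x' y' :=
  ⟨fun e => (h.symm.trans e).trans h', fun e => (h.trans e).trans h'.symm⟩

/-- Logarithms are compared only between elements of equal nonzero sign, where `ValEq` forces them
to agree. -/
lemma ValEq.valLT_congr [LinearOrder G] {x x' y y' : SignType × G} (h : ValEq x x')
    (h' : ValEq y y') : ValLT x y ↔ ValLT x' y' := by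
  obtain ⟨s, g⟩ := x
  obtain ⟨s', g'⟩ := x'
  obtain ⟨t, k⟩ := y
  obtain ⟨t', k'⟩ := y'
  obtain ⟨rfl, h⟩ := h
  obtain ⟨rfl, h'⟩ := h'
  simp only [ValLT] at *
  refine or_congr Iff.rfl (and_congr_right ?_)
  rintro rfl
  rcases h with rfl | rfl
  · simp
  · rcases h' with rfl | rfl
    · simp
    · rfl

variable [AddCommGroup G]

lemma ValEq.mul {x x' y y' : SignType × G} (h : ValEq x x') (h' : ValEq y y') :
    ValEq (x.1 * y.1, x.2 + y.2) (x'.1 * y'.1, x'.2 + y'.2) := by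
  refine ⟨by simp only [h.1, h'.1], ?_⟩
  rcases h.2 with h0 | h0
  · exact Or.inl (by simp [h0])
  · rcases h'.2 with h1 | h1
    · exact Or.inl (by simp [h1])
    · exact Or.inr (by simp [h0, h1])

lemma ValEq.inv {x x' : SignType × G} (h : ValEq x x') : ValEq (x.1, -x.2) (x'.1, -x'.2) :=
  ⟨h.1, h.2.imp_right fun h0 => by simp [h0]⟩

variable {n : ℕ} (v : Fin n → SignType × G)

lemma termVal_var (i : Fin n) : termVal (Term.var (Sum.inr i)) v = v i := by
  ext
  · simp [termVal, termSign]
  · simp [termVal, coef, linForm]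

lemma termVal_negOne (ts : Fin 0 → Lang.Term (Empty ⊕ Fin n)) :
    termVal (Term.func Func.negOne ts) v = (-1, 0) := by
  simp [termVal, termSign, coef, linForm]

lemma termVal_zero (ts : Fin 0 → Lang.Term (Empty ⊕ Fin n)) :
    termVal (Term.func Func.zero ts) v = (0, 0) := by
  simp [termVal, termSign, coef, linForm]

lemma termVal_one (ts : Fin 0 → Lang.Term (Empty ⊕ Fin n)) :
    termVal (Term.func Func.one ts) v = (1, 0) := by
  simp [termVal, termSign, coef, linForm]

lemma termVal_inv (ts : Fin 1 → Lang.Term (Empty ⊕ Fin n)) :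
    termVal (Term.func Func.inv ts) v = ((termVal (ts 0) v).1, -(termVal (ts 0) v).2) := by
  simp [termVal, termSign, coef, linForm]

lemma termVal_mul (ts : Fin 2 → Lang.Term (Empty ⊕ Fin n)) :
    termVal (Term.func Func.mul ts) v =
      ((termVal (ts 0) v).1 * (termVal (ts 1) v).1,
        (termVal (ts 0) v).2 + (termVal (ts 1) v).2) := by
  simp [termVal, termSign, coef, linForm, add_smul, Finset.sum_add_distrib]

end Values

/-- A description of an `L`-structure by signs and logarithms of absolute values. -/
structure Coordinates (M : Type) [Lang.Structure M] (G : Type) [AddCommGroup G]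
    [LinearOrder G] where
  /-- The sign and the logarithm of the absolute value of an element. -/
  val : M → SignType × G
  surj : ∀ y, ∃ x, ValEq (val x) y
  eq_iff : ∀ x y, x = y ↔ ValEq (val x) (val y)
  lt_iff : ∀ v : Fin 2 → M, Structure.RelMap (L := Lang) (Rel.lt : Lang.Relations 2) v ↔ ValLT (val (v 0)) (val (v 1))
  negOne : ∀ v : Fin 0 → M, ValEq (val (Structure.funMap (L := Lang) (Func.negOne : Lang.Functions 0) v)) (-1, 0)
  zero : ∀ v : Fin 0 → M, ValEq (val (Structure.funMap (L := Lang) (Func.zero : Lang.Functions 0) v)) (0, 0)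
  one : ∀ v : Fin 0 → M, ValEq (val (Structure.funMap (L := Lang) (Func.one : Lang.Functions 0) v)) (1, 0)
  inv : ∀ v : Fin 1 → M, ValEq (val (Structure.funMap (L := Lang) (Func.inv : Lang.Functions 1) v)) ((val (v 0)).1, -(val (v 0)).2)
  mul : ∀ v : Fin 2 → M, ValEq (val (Structure.funMap (L := Lang) (Func.mul : Lang.Functions 2) v))
    ((val (v 0)).1 * (val (v 1)).1, (val (v 0)).2 + (val (v 1)).2)

namespace Coordinates

variable {M G : Type} [Lang.Structure M] [AddCommGroup G] [LinearOrder G]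
  (C : Coordinates M G) {n : ℕ} (e : Empty → M)

/-- Agreement holds only up to `ValEq`: for a product with a factor zero, the logarithm computed
from the term need not be the one attached to zero. -/
lemma valEq_realize_term {x : Fin n → M} {v : Fin n → SignType × G}
    (h : ∀ i, ValEq (C.val (x i)) (v i)) : ∀ t : Lang.Term (Empty ⊕ Fin n),
    ValEq (C.val (t.realize (Sum.elim e x))) (termVal t v)
  | Term.var (Sum.inr i) => by simpa [termVal_var] using h i
  | Term.func Func.negOne ts => by
    rw [termVal_negOne]
    exact C.negOne _
  | Term.func Func.zero ts => by
    rw [termVal_zero]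
    exact C.zero _
  | Term.func Func.one ts => by
    rw [termVal_one]
    exact C.one _
  | Term.func Func.inv ts => by
    rw [termVal_inv]
    exact (C.inv _).trans (valEq_realize_term h (ts 0)).inv
  | Term.func Func.mul ts => by
    rw [termVal_mul]
    exact (C.mul _).trans ((valEq_realize_term h (ts 0)).mul (valEq_realize_term h (ts 1)))

/-- The statement allows arbitrary representatives `v` of the tuple, because in the quantifier step
a given pair is in general only `ValEq` to the coordinates of an element. -/
theorem realize_iff : ∀ {n : ℕ} (φ : Lang.BoundedFormula Empty n) {x : Fin n → M}
    {v : Fin n → SignType × G}, (∀ i, ValEq (C.val (x i)) (v i)) →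
    (φ.Realize e x ↔ Sat (fun _ => Set.univ) φ v)
  | _, BoundedFormula.falsum, x, v, _ => by simp only [BoundedFormula.Realize, Sat]
  | _, BoundedFormula.equal s t, x, v, h => by
    simp only [BoundedFormula.Realize, Sat]
    rw [C.eq_iff]
    exact (C.valEq_realize_term e h s).congr (C.valEq_realize_term e h t)
  | _, BoundedFormula.rel Rel.lt ts, x, v, h => by
    simp only [BoundedFormula.Realize, Sat]
    rw [C.lt_iff]
    exact (C.valEq_realize_term e h (ts 0)).valLT_congr (C.valEq_realize_term e h (ts 1))
  | _, BoundedFormula.imp φ ψ, x, v, h => by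
    simp only [BoundedFormula.Realize, Sat]
    rw [realize_iff φ h, realize_iff ψ h]
  | n, BoundedFormula.all φ, x, v, h => by
    simp only [BoundedFormula.Realize, Sat]
    have key : ∀ y w, ValEq (C.val y) w → ∀ i, ValEq (C.val (Fin.snoc (α := fun _ => M) x y i))
        (Fin.snoc (α := fun _ => SignType × G) v w i) := by
      intro y w hyw i
      refine Fin.lastCases ?_ (fun i => ?_) i
      · simpa using hyw
      · simpa using h i
    constructor
    · intro H s g _
      obtain ⟨y, hy⟩ := C.surj (s, g)
      exact (realize_iff φ (key y _ hy)).1 (H y)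
    · intro H y
      exact (realize_iff φ (key y _ (ValEq.refl _))).2 (H _ _ (Set.mem_univ _))

end Coordinates

/-- Two structures with coordinates in nontrivial divisible groups satisfy the same formulas at
similar tuples. -/
theorem Coordinates.realize_iff_of_similar {M M' G G' : Type} [Lang.Structure M]
    [Lang.Structure M'] [AddCommGroup G] [LinearOrder G] [IsOrderedAddMonoid G]
    [AddCommGroup G'] [LinearOrder G'] [IsOrderedAddMonoid G']
    (C : Coordinates M G) (C' : Coordinates M' G') {u : G} (hu : 0 < u) {u' : G'} (hu' : 0 < u')
    (hG : ∀ (m : ℕ) (g : G), 1 ≤ m → ∃ h : G, g = m • h)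
    (hG' : ∀ (m : ℕ) (g : G'), 1 ≤ m → ∃ h : G', g = m • h)
    {n : ℕ} (φ : Lang.BoundedFormula Empty n) (e : Empty → M) (e' : Empty → M') (x : Fin n → M)
    (x' : Fin n → M')
    (h : Similar (coefBound (code φ + 2) (code φ)) (fun i => C.val (x i)) fun i => C'.val (x' i)) :
    φ.Realize e x ↔ φ.Realize e' x' := by
  rw [C.realize_iff e φ fun _ => ValEq.refl _, C'.realize_iff e' φ fun _ => ValEq.refl _]
  -- The code bounds the quantifier depth, so `code φ` levels below the level `n` are enough; the
  -- bound at level `n` is then the one in `h`.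
  refine sat_iff_of_similar (Q := n + code φ) (K := code φ + 2)
    (β := fun m => coefBound (code φ + 2) (n + code φ - m)) (rich_univ hu hG _ _)
    (rich_univ hu' hG' _ _) (fun m hm => (coefBound_sub hm).le) (fun m _ => le_coefBound _ _)
    φ _ _ (fun _ => Set.mem_univ _) (fun _ => Set.mem_univ _) le_rfl le_rfl ?_
  simpa using h

/-- Signs and logarithms of real numbers. -/
noncomputable def realCoordinates : Coordinates ℝ ℝ where
  val x := (SignType.sign x, Real.log |x|)
  surj := by
    rintro ⟨s, g⟩
    rcases s.trichotomy with rfl | rfl | rfl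
    · exact ⟨-Real.exp g, by simp [Real.exp_pos], by simp⟩
    · exact ⟨0, by simp, by simp⟩
    · exact ⟨Real.exp g, by simp [Real.exp_pos], by simp⟩
  eq_iff x y := by
    constructor
    · rintro rfl
      exact ValEq.refl _
    · rintro ⟨h1, h2⟩
      simp only at h1 h2
      rcases h2 with h2 | h2
      · rw [h2, eq_comm, sign_eq_zero_iff] at h1
        rw [sign_eq_zero_iff] at h2
        rw [h1, h2]
      · rcases eq_or_ne x 0 with rfl | hx
        · rw [sign_zero, eq_comm, sign_eq_zero_iff] at h1
          exact h1.symm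
        · have hy : y ≠ 0 := by
            rintro rfl
            rw [sign_zero, sign_eq_zero_iff] at h1
            exact hx h1
          have h3 := Real.log_injOn_pos (abs_pos.2 hx) (abs_pos.2 hy) h2
          rw [← sign_mul_abs x, ← sign_mul_abs y, h1, h3]
  lt_iff v := by
    change v 0 < v 1 ↔ _
    generalize v 0 = x
    generalize v 1 = y
    simp only [ValLT]
    rcases lt_trichotomy x 0 with hx | rfl | hx <;> rcases lt_trichotomy y 0 with hy | rfl | hy
    · rw [sign_neg hx, sign_neg hy, Real.log_lt_log_iff (abs_pos.2 hy.ne) (abs_pos.2 hx.ne),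
        abs_of_neg hx, abs_of_neg hy]
      simp
    · simp [sign_neg hx, hx]
    · simp [sign_neg hx, sign_pos hy, hx.trans hy]
    · simp [sign_neg hy, hy.le]
    · simp
    · simp [sign_pos hy, hy]
    · simp [sign_pos hx, sign_neg hy, (hy.trans hx).le]
    · simp [sign_pos hx, hx.le]
    · rw [sign_pos hx, sign_pos hy, Real.log_lt_log_iff (abs_pos.2 hx.ne') (abs_pos.2 hy.ne'),
        abs_of_pos hx, abs_of_pos hy]
      simp
  negOne v := by
    change ValEq (SignType.sign (-1 : ℝ), Real.log |(-1 : ℝ)|) _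
    simpa using ValEq.refl _
  zero v := by
    change ValEq (SignType.sign (0 : ℝ), Real.log |(0 : ℝ)|) _
    simpa using ValEq.refl _
  one v := by
    change ValEq (SignType.sign (1 : ℝ), Real.log |(1 : ℝ)|) _
    simpa using ValEq.refl _
  inv v := by
    change ValEq (SignType.sign (v 0)⁻¹, Real.log |(v 0)⁻¹|) _
    generalize v 0 = x
    rw [abs_inv, Real.log_inv]
    refine ⟨?_, Or.inr rfl⟩
    rcases lt_trichotomy x 0 with hx | rfl | hx
    · simp [sign_neg hx, sign_neg (inv_lt_zero.2 hx)]
    · simp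
    · simp [sign_pos hx, sign_pos (inv_pos.2 hx)]
  mul v := by
    change ValEq (SignType.sign (v 0 * v 1), Real.log |v 0 * v 1|) _
    generalize v 0 = x
    generalize v 1 = y
    refine ⟨sign_mul _ _, ?_⟩
    rcases eq_or_ne x 0 with rfl | hx
    · simp
    rcases eq_or_ne y 0 with rfl | hy
    · simp
    · right
      simp only
      rw [abs_mul, Real.log_mul (abs_ne_zero.2 hx) (abs_ne_zero.2 hy)]

lemma exists_eq_nsmul_real (m : ℕ) (g : ℝ) (hm : 1 ≤ m) : ∃ h : ℝ, g = m • h := by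
  have : (m : ℝ) ≠ 0 := by positivity
  exact ⟨g / m, by rw [nsmul_eq_mul]; field_simp⟩

end OrdMul

/-! ### Signed groups: the algebra behind the axioms. -/

namespace OrdMul

/-- The algebraic part of the axiom system: a commutative group with zero, ordered in such a way
that multiplication by a positive element preserves and by a negative one reverses the order, with
a distinguished negative square root of one. -/
class SignedGroup (M : Type) extends CommGroupWithZero M, LinearOrder M where
  /-- The negative square root of one. -/
  negOne : M
  zero_lt_one' : (0 : M) < 1
  negOne_lt : negOne < 0
  negOne_mul_self : negOne * negOne = 1
  mul_lt_mul_pos : ∀ x y z : M, x < y → 0 < z → x * z < y * z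
  mul_lt_mul_neg : ∀ x y z : M, x < y → z < 0 → y * z < x * z

namespace SignedGroup

variable {M : Type} [SignedGroup M]

lemma mul_pos_of_pos {x y : M} (hx : 0 < x) (hy : 0 < y) : 0 < x * y := by
  simpa using mul_lt_mul_pos 0 x y hx hy

lemma mul_neg_of_pos {x y : M} (hx : 0 < x) (hy : y < 0) : x * y < 0 := by
  simpa using mul_lt_mul_neg 0 x y hx hy

lemma mul_pos_of_neg {x y : M} (hx : x < 0) (hy : y < 0) : 0 < x * y := by
  simpa using mul_lt_mul_neg x 0 y hx hy

lemma negOne_mul_pos {x : M} (hx : x < 0) : 0 < negOne * x := mul_pos_of_neg negOne_lt hx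

lemma negOne_mul_negOne_mul (x : M) : negOne * (negOne * x) = x := by
  rw [← mul_assoc, negOne_mul_self, one_mul]

lemma negOne_mul_neg {x : M} (hx : 0 < x) : negOne * x < 0 := by
  rw [mul_comm]
  exact mul_neg_of_pos hx negOne_lt

lemma inv_pos_of_pos {x : M} (hx : 0 < x) : 0 < x⁻¹ := by
  rcases lt_trichotomy x⁻¹ 0 with h | h | h
  · have := mul_neg_of_pos hx h
    rw [mul_inv_cancel₀ hx.ne'] at this
    exact absurd this zero_lt_one'.not_gt
  · exact absurd (inv_eq_zero.1 h) hx.ne'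
  · exact h

lemma inv_negOne : (negOne : M)⁻¹ = negOne := inv_eq_of_mul_eq_one_left negOne_mul_self

lemma inv_neg_of_neg {x : M} (hx : x < 0) : x⁻¹ < 0 := by
  have h := inv_pos_of_pos (negOne_mul_pos hx)
  rw [mul_inv, inv_negOne] at h
  simpa [negOne_mul_negOne_mul] using negOne_mul_neg h

variable (M) in
/-- The positive elements. -/
abbrev Pos : Type := {x : M // 0 < x}

instance : CommGroup (Pos M) where
  mul x y := ⟨x.1 * y.1, mul_pos_of_pos x.2 y.2⟩
  one := ⟨1, zero_lt_one'⟩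
  inv x := ⟨x.1⁻¹, inv_pos_of_pos x.2⟩
  mul_assoc x y z := Subtype.ext (mul_assoc x.1 y.1 z.1)
  one_mul x := Subtype.ext (one_mul x.1)
  mul_one x := Subtype.ext (mul_one x.1)
  mul_comm x y := Subtype.ext (mul_comm x.1 y.1)
  inv_mul_cancel x := Subtype.ext (inv_mul_cancel₀ x.2.ne')

lemma Pos.coe_mul (x y : Pos M) : ((x * y : Pos M) : M) = x * y := rfl

lemma Pos.coe_one : ((1 : Pos M) : M) = 1 := rfl

lemma Pos.coe_pow (x : Pos M) (n : ℕ) : ((x ^ n : Pos M) : M) = (x : M) ^ n := by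
  induction n with
  | zero => simp [Pos.coe_one]
  | succ n ih => rw [pow_succ, Pos.coe_mul, ih, pow_succ]

instance : IsOrderedMonoid (Pos M) where
  mul_le_mul_left x y h z := by
    rcases h.eq_or_lt with rfl | h
    · exact le_rfl
    · exact (mul_lt_mul_pos x.1 y.1 z.1 h z.2).le

/-- The sign and the absolute value of an element, written additively. -/
noncomputable def signAbs (x : M) : SignType × Additive (Pos M) :=
  if h : 0 < x then (1, Additive.ofMul ⟨x, h⟩)
  else if h : x < 0 then (-1, Additive.ofMul ⟨negOne * x, negOne_mul_pos h⟩) else (0, 0)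

lemma signAbs_of_pos {x : M} (h : 0 < x) : signAbs x = (1, Additive.ofMul ⟨x, h⟩) := dif_pos h

lemma signAbs_of_neg {x : M} (h : x < 0) :
    signAbs x = (-1, Additive.ofMul ⟨negOne * x, negOne_mul_pos h⟩) := by
  rw [signAbs, dif_neg h.not_gt, dif_pos h]

lemma signAbs_zero : signAbs (0 : M) = (0, 0) := by
  rw [signAbs, dif_neg (lt_irrefl _), dif_neg (lt_irrefl _)]

lemma mul_left_cancel_negOne {x y : M} (h : negOne * x = negOne * y) : x = y := by
  rw [← negOne_mul_negOne_mul x, h, negOne_mul_negOne_mul]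

lemma negOne_mul_lt_iff {x y : M} : negOne * x < negOne * y ↔ y < x := by
  constructor
  · intro h
    have := mul_lt_mul_neg _ _ negOne h negOne_lt
    rwa [mul_comm, negOne_mul_negOne_mul, mul_comm, negOne_mul_negOne_mul] at this
  · intro h
    have := mul_lt_mul_neg _ _ negOne h negOne_lt
    rwa [mul_comm, mul_comm y] at this

lemma ofMul_eq_iff {x y : M} (hx : 0 < x) (hy : 0 < y) :
    (Additive.ofMul (⟨x, hx⟩ : Pos M) = Additive.ofMul ⟨y, hy⟩) ↔ x = y := by
  rw [Additive.ofMul.apply_eq_iff_eq, Subtype.mk.injEq]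

lemma ofMul_add {x y : M} (hx : 0 < x) (hy : 0 < y) :
    Additive.ofMul (⟨x, hx⟩ : Pos M) + Additive.ofMul ⟨y, hy⟩ =
      Additive.ofMul ⟨x * y, mul_pos_of_pos hx hy⟩ := rfl

lemma neg_ofMul {x : M} (hx : 0 < x) :
    -Additive.ofMul (⟨x, hx⟩ : Pos M) = Additive.ofMul ⟨x⁻¹, inv_pos_of_pos hx⟩ := rfl

lemma signAbs_surj (y : SignType × Additive (Pos M)) : ∃ x : M, ValEq (signAbs x) y := by
  obtain ⟨s, ⟨g, hg⟩⟩ := y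
  rcases s.trichotomy with rfl | rfl | rfl
  · refine ⟨negOne * g, ?_⟩
    rw [signAbs_of_neg (negOne_mul_neg hg)]
    refine ⟨rfl, Or.inr ((ofMul_eq_iff _ hg).2 (negOne_mul_negOne_mul g))⟩
  · exact ⟨0, by rw [signAbs_zero]; exact ⟨rfl, Or.inl rfl⟩⟩
  · exact ⟨g, by rw [signAbs_of_pos hg]; exact ⟨rfl, Or.inr rfl⟩⟩

lemma signAbs_eq_iff (x y : M) : x = y ↔ ValEq (signAbs x) (signAbs y) := by
  constructor
  · rintro rfl
    exact ValEq.refl _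
  · rintro ⟨h1, h2⟩
    rcases lt_trichotomy x 0 with hx | rfl | hx <;> rcases lt_trichotomy y 0 with hy | rfl | hy
    · simp only [signAbs_of_neg hx, signAbs_of_neg hy, ofMul_eq_iff] at h2
      exact mul_left_cancel_negOne (by simpa using h2)
    · simp [signAbs_of_neg hx, signAbs_zero] at h1
    · simp [signAbs_of_neg hx, signAbs_of_pos hy] at h1
    · simp [signAbs_of_neg hy, signAbs_zero] at h1
    · rfl
    · simp [signAbs_of_pos hy, signAbs_zero] at h1
    · simp [signAbs_of_pos hx, signAbs_of_neg hy] at h1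
    · simp [signAbs_of_pos hx, signAbs_zero] at h1
    · simp only [signAbs_of_pos hx, signAbs_of_pos hy, ofMul_eq_iff] at h2
      simpa using h2

lemma signAbs_lt_iff (x y : M) : x < y ↔ ValLT (signAbs x) (signAbs y) := by
  simp only [ValLT]
  rcases lt_trichotomy x 0 with hx | rfl | hx <;> rcases lt_trichotomy y 0 with hy | rfl | hy
  · simp [signAbs_of_neg hx, signAbs_of_neg hy, negOne_mul_lt_iff]
  · simp [signAbs_of_neg hx, signAbs_zero, hx]
  · simp [signAbs_of_neg hx, signAbs_of_pos hy, hx.trans hy]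
  · simp [signAbs_of_neg hy, signAbs_zero, hy.le]
  · simp [signAbs_zero]
  · simp [signAbs_of_pos hy, signAbs_zero, hy]
  · simp [signAbs_of_pos hx, signAbs_of_neg hy, (hy.trans hx).le]
  · simp [signAbs_of_pos hx, signAbs_zero, hx.le]
  · simp [signAbs_of_pos hx, signAbs_of_pos hy]

lemma signAbs_inv (x : M) : ValEq (signAbs x⁻¹) ((signAbs x).1, -(signAbs x).2) := by
  rcases lt_trichotomy x 0 with hx | rfl | hx
  · rw [signAbs_of_neg hx, signAbs_of_neg (inv_neg_of_neg hx)]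
    refine ⟨rfl, Or.inr ?_⟩
    simp only [neg_ofMul]
    rw [ofMul_eq_iff, mul_inv, inv_negOne]
  · rw [inv_zero, signAbs_zero]
    exact ⟨rfl, Or.inl rfl⟩
  · rw [signAbs_of_pos hx, signAbs_of_pos (inv_pos_of_pos hx)]
    exact ⟨rfl, Or.inr rfl⟩

lemma signAbs_mul (x y : M) : ValEq (signAbs (x * y))
    ((signAbs x).1 * (signAbs y).1, (signAbs x).2 + (signAbs y).2) := by
  rcases eq_or_ne x 0 with rfl | hx0
  · rw [zero_mul, signAbs_zero]
    exact ⟨(zero_mul _).symm, Or.inl rfl⟩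
  rcases eq_or_ne y 0 with rfl | hy0
  · rw [mul_zero, signAbs_zero]
    exact ⟨(mul_zero _).symm, Or.inl rfl⟩
  rcases hx0.lt_or_gt with hx | hx <;> rcases hy0.lt_or_gt with hy | hy
  · rw [signAbs_of_neg hx, signAbs_of_neg hy, signAbs_of_pos (mul_pos_of_neg hx hy)]
    refine ⟨rfl, Or.inr ?_⟩
    simp only [ofMul_add]
    rw [ofMul_eq_iff, mul_mul_mul_comm, negOne_mul_self, one_mul]
  · rw [signAbs_of_neg hx, signAbs_of_pos hy,
      signAbs_of_neg (by rw [mul_comm]; exact mul_neg_of_pos hy hx)]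
    refine ⟨rfl, Or.inr ?_⟩
    simp only [ofMul_add]
    rw [ofMul_eq_iff, mul_assoc]
  · rw [signAbs_of_pos hx, signAbs_of_neg hy, signAbs_of_neg (mul_neg_of_pos hx hy)]
    refine ⟨rfl, Or.inr ?_⟩
    simp only [ofMul_add]
    rw [ofMul_eq_iff, mul_left_comm]
  · rw [signAbs_of_pos hx, signAbs_of_pos hy, signAbs_of_pos (mul_pos_of_pos hx hy)]
    exact ⟨rfl, Or.inr rfl⟩

lemma signAbs_negOne : signAbs (negOne : M) = (-1, 0) := by
  rw [signAbs_of_neg negOne_lt, Prod.mk.injEq]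
  refine ⟨rfl, congrArg Additive.ofMul (Subtype.ext negOne_mul_self)⟩

lemma signAbs_one : signAbs (1 : M) = (1, 0) := by
  rw [signAbs_of_pos zero_lt_one']
  rfl

/-- Even powers of a negative element are positive, hence its odd powers are negative. Thus odd
roots of positive elements stay in the group of positive elements. -/
lemma pos_of_pow_odd_pos {y : M} {k : ℕ} (h : 0 < y ^ (2 * k + 1)) : 0 < y := by
  by_contra! hy
  rcases hy.lt_or_eq with hy | rfl
  · have hsq : ∀ j : ℕ, 0 < y ^ (2 * j) := by
      intro j
      induction j with
      | zero => simpa using zero_lt_one'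
      | succ j ih =>
        rw [show 2 * (j + 1) = 2 * j + 2 by ring, pow_add, pow_two]
        exact mul_pos_of_pos ih (mul_pos_of_neg hy hy)
    rw [pow_succ] at h
    exact (mul_neg_of_pos (hsq k) hy).not_gt h
  · simp at h

/-- Odd roots and square roots of positive elements make the positive elements divisible. -/
lemma exists_eq_nsmul (hodd : ∀ (k : ℕ) (x : M), ∃ y, x = y ^ (2 * k + 1))
    (hsq : ∀ x : M, 0 < x → ∃ y, y ≠ 0 ∧ x = y ^ 2) (m : ℕ) :
    ∀ g : Additive (Pos M), 1 ≤ m → ∃ h, g = m • h := by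
  have hsq' : ∀ x : M, 0 < x → ∃ y, 0 < y ∧ x = y ^ 2 := by
    intro x hx
    obtain ⟨y, hy0, rfl⟩ := hsq x hx
    rcases hy0.lt_or_gt with hy | hy
    · exact ⟨negOne * y, negOne_mul_pos hy, by rw [mul_pow, pow_two negOne, negOne_mul_self,
        one_mul]⟩
    · exact ⟨y, hy, rfl⟩
  induction m using Nat.strong_induction_on with
  | _ m ih =>
    rintro ⟨x, hx⟩ hm
    -- For even `m` a positive square root is taken and the induction continues with `m / 2`; for
    -- odd `m` a single odd root suffices.
    rcases Nat.even_or_odd' m with ⟨k, rfl | rfl⟩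
    · obtain ⟨y, hy, hxy⟩ := hsq' x hx
      obtain ⟨h, hh⟩ := ih k (by lia) (Additive.ofMul ⟨y, hy⟩) (by lia)
      refine ⟨h, ?_⟩
      rw [mul_nsmul', ← hh]
      exact congrArg Additive.ofMul (Subtype.ext (hxy.trans (Pos.coe_pow ⟨y, hy⟩ 2).symm))
    · obtain ⟨y, hxy⟩ := hodd k x
      have hy : 0 < y := pos_of_pow_odd_pos (hxy ▸ hx)
      exact ⟨Additive.ofMul ⟨y, hy⟩,
        congrArg Additive.ofMul (Subtype.ext (hxy.trans (Pos.coe_pow ⟨y, hy⟩ _).symm))⟩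

/-- The symbols of `L` have their meaning in a signed group. -/
structure Compatible (M : Type) [SignedGroup M] [Lang.Structure M] : Prop where
  lt : ∀ v : Fin 2 → M,
    Structure.RelMap (L := Lang) (Rel.lt : Lang.Relations 2) v ↔ v 0 < v 1
  negOne : ∀ v : Fin 0 → M,
    Structure.funMap (L := Lang) (Func.negOne : Lang.Functions 0) v = SignedGroup.negOne
  zero : ∀ v : Fin 0 → M, Structure.funMap (L := Lang) (Func.zero : Lang.Functions 0) v = 0
  one : ∀ v : Fin 0 → M, Structure.funMap (L := Lang) (Func.one : Lang.Functions 0) v = 1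
  inv : ∀ v : Fin 1 → M, Structure.funMap (L := Lang) (Func.inv : Lang.Functions 1) v = (v 0)⁻¹
  mul : ∀ v : Fin 2 → M,
    Structure.funMap (L := Lang) (Func.mul : Lang.Functions 2) v = v 0 * v 1

/-- Signs and absolute values in a signed group. -/
noncomputable def coordinates [Lang.Structure M] (h : Compatible M) :
    Coordinates M (Additive (Pos M)) where
  val := signAbs
  surj := signAbs_surj
  eq_iff := signAbs_eq_iff
  lt_iff v := (h.lt v).trans (signAbs_lt_iff _ _)
  negOne v := by rw [h.negOne, signAbs_negOne]; exact ValEq.refl _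
  zero v := by rw [h.zero, signAbs_zero]; exact ValEq.refl _
  one v := by rw [h.one, signAbs_one]; exact ValEq.refl _
  inv v := by rw [h.inv]; exact signAbs_inv _
  mul v := by rw [h.mul]; exact signAbs_mul _ _

end SignedGroup

end OrdMul

namespace OrdMul

/-! ### The meaning of the symbols and the axioms in a structure. -/

section Realize

variable {M : Type} [Lang.Structure M] {α : Type} {n : ℕ}

/-- Multiplication in an `L`-structure. -/
def mulM (x y : M) : M := Structure.funMap (L := Lang) (Func.mul : Lang.Functions 2) ![x, y]

/-- Inversion in an `L`-structure. -/
def invM (x : M) : M := Structure.funMap (L := Lang) (Func.inv : Lang.Functions 1) ![x]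

variable (M) in
/-- The constant `-1` of an `L`-structure. -/
def negOneM : M := Structure.funMap (L := Lang) (Func.negOne : Lang.Functions 0) ![]

variable (M) in
/-- The constant `0` of an `L`-structure. -/
def zeroM : M := Structure.funMap (L := Lang) (Func.zero : Lang.Functions 0) ![]

variable (M) in
/-- The constant `1` of an `L`-structure. -/
def oneM : M := Structure.funMap (L := Lang) (Func.one : Lang.Functions 0) ![]

/-- The order of an `L`-structure. -/
def LtM (x y : M) : Prop := Structure.RelMap (L := Lang) (Rel.lt : Lang.Relations 2) ![x, y]

/-- Powers in an `L`-structure. -/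
def powM (x : M) : ℕ → M
  | 0 => oneM M
  | 1 => x
  | k + 2 => mulM (powM x (k + 1)) x

@[simp]
lemma realize_tMul (s t : Lang.Term α) (w : α → M) :
    (tMul s t).realize w = mulM (s.realize w) (t.realize w) :=
  congrArg (Structure.funMap (L := Lang) (Func.mul : Lang.Functions 2))
    (by funext i; fin_cases i <;> rfl)

@[simp]
lemma realize_tInv (s : Lang.Term α) (w : α → M) : (tInv s).realize w = invM (s.realize w) :=
  congrArg (Structure.funMap (L := Lang) (Func.inv : Lang.Functions 1))
    (by funext i; fin_cases i; rfl)

@[simp]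
lemma realize_tNegOne (w : α → M) : (tNegOne : Lang.Term α).realize w = negOneM M :=
  congrArg (Structure.funMap (L := Lang) (Func.negOne : Lang.Functions 0))
    (by funext i; exact i.elim0)

@[simp]
lemma realize_tZero (w : α → M) : (tZero : Lang.Term α).realize w = zeroM M :=
  congrArg (Structure.funMap (L := Lang) (Func.zero : Lang.Functions 0))
    (by funext i; exact i.elim0)

@[simp]
lemma realize_tOne (w : α → M) : (tOne : Lang.Term α).realize w = oneM M :=
  congrArg (Structure.funMap (L := Lang) (Func.one : Lang.Functions 0))
    (by funext i; exact i.elim0)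

@[simp]
lemma realize_tPow (t : Lang.Term α) (w : α → M) :
    ∀ k, (tPow t k).realize w = powM (t.realize w) k
  | 0 => realize_tOne w
  | 1 => rfl
  | k + 2 => by rw [tPow, powM, realize_tMul, realize_tPow t w (k + 1)]

@[simp]
lemma realize_fLt (s t : Lang.Term (α ⊕ Fin n)) (e : α → M) (x : Fin n → M) :
    (fLt s t).Realize e x ↔ LtM (s.realize (Sum.elim e x)) (t.realize (Sum.elim e x)) := by
  refine iff_of_eq (congrArg (Structure.RelMap (L := Lang) (Rel.lt : Lang.Relations 2)) ?_)
  funext i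
  fin_cases i <;> rfl

end Realize

section Axioms

variable (M : Type) [Lang.Structure M]

lemma realize_axO1 :
    M ⊨ axO1 ↔ ∀ x y : M, LtM x y → ¬ LtM y x := by
  simp [axO1, Sentence.Realize, Formula.Realize, Fin.snoc]

lemma realize_axO2 :
    M ⊨ axO2 ↔ ∀ x y z : M, LtM x y → LtM y z → LtM x z := by
  simp [axO2, Sentence.Realize, Formula.Realize, Fin.snoc]

lemma realize_axO3 :
    M ⊨ axO3 ↔ ∀ x y : M, LtM x y ∨ x = y ∨ LtM y x := by
  simp [axO3, Sentence.Realize, Formula.Realize, Fin.snoc]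

lemma realize_axM1 :
    M ⊨ axM1 ↔ ∀ x y z : M, mulM x (mulM y z) = mulM (mulM x y) z := by
  simp [axM1, Sentence.Realize, Formula.Realize, Fin.snoc]

lemma realize_axM2 :
    M ⊨ axM2 ↔ ∀ x : M, mulM x (oneM M) = x ∧ mulM x (zeroM M) = zeroM M ∧ zeroM M = invM (zeroM M) := by
  simp [axM2, Sentence.Realize, Formula.Realize, Fin.snoc]

lemma realize_axM3 :
    M ⊨ axM3 ↔ ∀ x : M, x ≠ zeroM M → mulM x (invM x) = oneM M := by
  simp [axM3, Sentence.Realize, Formula.Realize, Fin.snoc]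

lemma realize_axM4 :
    M ⊨ axM4 ↔ ∀ x y : M, mulM x y = mulM y x := by
  simp [axM4, Sentence.Realize, Formula.Realize, Fin.snoc]

lemma realize_axM5pos :
    M ⊨ axM5pos ↔ ∀ x y z : M, LtM x y → LtM (zeroM M) z → LtM (mulM x z) (mulM y z) := by
  simp [axM5pos, Sentence.Realize, Formula.Realize, Fin.snoc]

lemma realize_axM5neg :
    M ⊨ axM5neg ↔ ∀ x y z : M, LtM x y → LtM z (zeroM M) → LtM (mulM y z) (mulM x z) := by
  simp [axM5neg, Sentence.Realize, Formula.Realize, Fin.snoc]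

lemma realize_axM6 :
    M ⊨ axM6 ↔ ∃ y : M, LtM (negOneM M) (zeroM M) ∧ LtM (zeroM M) (oneM M) ∧ LtM (oneM M) y := by
  simp [axM6, Sentence.Realize, Formula.Realize, Fin.snoc]

lemma realize_axM7 (n : ℕ) :
    M ⊨ axM7 n ↔ ∀ x : M, ∃ y, x = powM y (2 * n + 1) := by
  simp [axM7, Sentence.Realize, Formula.Realize, Fin.snoc]

lemma realize_axM8 (n : ℕ) :
    M ⊨ axM8 n ↔ ∀ x : M, powM x (2 * n) = oneM M ↔ (x = oneM M ∨ x = negOneM M) := by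
  simp [axM8, Sentence.Realize, Formula.Realize, Fin.snoc]

lemma realize_axM9 :
    M ⊨ axM9 ↔ ∀ x : M, LtM (zeroM M) x ↔ ∃ y, y ≠ zeroM M ∧ x = powM y 2 := by
  simp [axM9, Sentence.Realize, Formula.Realize, Fin.snoc]

variable {M}

lemma model_realTheory_iff : M ⊨ realTheory ↔
    (M ⊨ axO1 ∧ M ⊨ axO2 ∧ M ⊨ axO3 ∧ M ⊨ axM1 ∧ M ⊨ axM2 ∧ M ⊨ axM3 ∧ M ⊨ axM4 ∧ M ⊨ axM5pos ∧
      M ⊨ axM5neg ∧ M ⊨ axM6 ∧ M ⊨ axM9) ∧ (∀ n, M ⊨ axM7 n) ∧ ∀ n, 1 ≤ n → M ⊨ axM8 n := by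
  simp only [Theory.model_iff, realTheory, Set.mem_union, Set.mem_insert_iff,
    Set.mem_singleton_iff, Set.mem_ofPred_eq]
  constructor
  · intro h
    refine ⟨⟨?_, ?_, ?_, ?_, ?_, ?_, ?_, ?_, ?_, ?_, ?_⟩, fun n => ?_, fun n hn => ?_⟩
    all_goals first
      | exact h _ (Or.inr ⟨n, hn, rfl⟩)
      | exact h _ (Or.inl (Or.inr ⟨n, rfl⟩))
      | exact h _ (Or.inl (Or.inl (by simp only [true_or, or_true])))
  · rintro ⟨⟨h1, h2, h3, h4, h5, h6, h7, h8, h9, h10, h11⟩, h12, h13⟩ φ hφ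
    rcases hφ with (hφ | ⟨n, rfl⟩) | ⟨n, hn, rfl⟩
    · rcases hφ with rfl | rfl | rfl | rfl | rfl | rfl | rfl | rfl | rfl | rfl | rfl <;> assumption
    · exact h12 n
    · exact h13 n hn

end Axioms

/-! ### Models of the axioms and completeness. -/

section Models

variable {M : Type} [Lang.Structure M]

open Classical in
/-- A model of the axioms is a signed group. -/
noncomputable abbrev toSignedGroup (h : M ⊨ realTheory) : SignedGroup M :=
  have h' := model_realTheory_iff.1 h
  have hO1 := (realize_axO1 M).1 h'.1.1
  have hO2 := (realize_axO2 M).1 h'.1.2.1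
  have hO3 := (realize_axO3 M).1 h'.1.2.2.1
  have hM1 := (realize_axM1 M).1 h'.1.2.2.2.1
  have hM2 := (realize_axM2 M).1 h'.1.2.2.2.2.1
  have hM3 := (realize_axM3 M).1 h'.1.2.2.2.2.2.1
  have hM4 := (realize_axM4 M).1 h'.1.2.2.2.2.2.2.1
  have hM5 := (realize_axM5pos M).1 h'.1.2.2.2.2.2.2.2.1
  have hM5' := (realize_axM5neg M).1 h'.1.2.2.2.2.2.2.2.2.1
  have hM6 := (realize_axM6 M).1 h'.1.2.2.2.2.2.2.2.2.2.1
  have hM8 := (realize_axM8 M 1).1 (h'.2.2 1 le_rfl)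
  have hlt : ∀ x, ¬ LtM (M := M) x x := fun x hx => hO1 x x hx hx
  { mul := mulM
    one := oneM M
    zero := zeroM M
    inv := invM
    mul_assoc := fun x y z => (hM1 x y z).symm
    one_mul := fun x => (hM4 _ _).trans (hM2 x).1
    mul_one := fun x => (hM2 x).1
    mul_comm := hM4
    zero_mul := fun x => (hM4 _ _).trans (hM2 x).2.1
    mul_zero := fun x => (hM2 x).2.1
    inv_zero := (hM2 (zeroM M)).2.2.symm
    mul_inv_cancel := hM3
    exists_pair_ne := ⟨zeroM M, oneM M, fun e => by
      obtain ⟨y, -, h, -⟩ := hM6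
      exact hlt _ (e ▸ h)⟩
    le := fun x y => x = y ∨ LtM x y
    lt := LtM
    le_refl := fun x => Or.inl rfl
    le_trans := by
      rintro x y z (rfl | hxy) (rfl | hyz)
      · exact Or.inl rfl
      · exact Or.inr hyz
      · exact Or.inr hxy
      · exact Or.inr (hO2 _ _ _ hxy hyz)
    lt_iff_le_not_ge := by
      intro x y
      constructor
      · intro hxy
        refine ⟨Or.inr hxy, ?_⟩
        rintro (rfl | hyx)
        · exact hlt _ hxy
        · exact hO1 _ _ hxy hyx
      · rintro ⟨rfl | hxy, hyx⟩
        · exact absurd (Or.inl rfl) hyx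
        · exact hxy
    le_antisymm := by
      rintro x y (rfl | hxy) (hyx | hyx)
      · rfl
      · rfl
      · exact hyx.symm
      · exact absurd hyx (hO1 _ _ hxy)
    le_total := by
      intro x y
      rcases hO3 x y with h | h | h
      · exact Or.inl (Or.inr h)
      · exact Or.inl (Or.inl h)
      · exact Or.inr (Or.inr h)
    toDecidableLE := Classical.decRel _
    negOne := negOneM M
    zero_lt_one' := hM6.elim fun _ h => h.2.1
    negOne_lt := hM6.elim fun _ h => h.1
    -- The axiom `axM8 1`, read from right to left at `-1`, says that the square of `-1` is `1`.
    negOne_mul_self := (hM8 _).2 (Or.inr rfl)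
    mul_lt_mul_pos := hM5
    mul_lt_mul_neg := hM5' }

lemma toSignedGroup_compatible (h : M ⊨ realTheory) :
    letI := toSignedGroup h
    SignedGroup.Compatible M := by
  let := toSignedGroup h
  refine ⟨fun v => ?_, fun v => ?_, fun v => ?_, fun v => ?_, fun v => ?_, fun v => ?_⟩
  · change _ ↔ LtM (v 0) (v 1)
    refine iff_of_eq (congrArg (Structure.RelMap (L := Lang) (Rel.lt : Lang.Relations 2)) ?_)
    funext i
    fin_cases i <;> rfl
  all_goals exact congrArg _ (by funext i; fin_cases i <;> rfl)

lemma powM_eq_pow (h : M ⊨ realTheory) (x : M) :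
    letI := toSignedGroup h
    ∀ k : ℕ, powM x k = x ^ k := by
  let := toSignedGroup h
  intro k
  induction k using Nat.strong_induction_on with
  | _ k ih =>
    match k with
    | 0 => rw [pow_zero]; rfl
    | 1 => rw [pow_one]; rfl
    | k + 2 => rw [pow_succ, ← ih (k + 1) (by lia)]; rfl

/-- A model of the axioms has coordinates in a nontrivial divisible ordered group. -/
theorem exists_coordinates (h : M ⊨ realTheory) :
    ∃ (G : Type) (_ : AddCommGroup G) (_ : LinearOrder G) (_ : IsOrderedAddMonoid G) (u : G),
      0 < u ∧ (∀ (m : ℕ) (g : G), 1 ≤ m → ∃ h : G, g = m • h) ∧ Nonempty (Coordinates M G) := by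
  let := toSignedGroup h
  have h' := model_realTheory_iff.1 h
  have hM6 := (realize_axM6 M).1 h'.1.2.2.2.2.2.2.2.2.2.1
  have hM9 := (realize_axM9 M).1 h'.1.2.2.2.2.2.2.2.2.2.2
  obtain ⟨y, -, h01, h1y⟩ := hM6
  -- The element above `1` has a positive logarithm. This excludes the structure with only `-1`, `0`
  -- and `1`, whose group of logarithms is trivial.
  have h0y : (0 : M) < y := lt_trans (b := (1 : M)) h01 h1y
  refine ⟨Additive (SignedGroup.Pos M), inferInstance, inferInstance, inferInstance,
    Additive.ofMul ⟨y, h0y⟩, h1y, SignedGroup.exists_eq_nsmul ?_ ?_,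
    ⟨SignedGroup.coordinates (toSignedGroup_compatible h)⟩⟩
  · intro k x
    obtain ⟨z, hz⟩ := (realize_axM7 M k).1 (h'.2.1 k) x
    exact ⟨z, hz.trans (powM_eq_pow h z _)⟩
  · intro x hx
    obtain ⟨z, hz0, hz⟩ := (hM9 x).1 hx
    exact ⟨z, hz0, hz.trans (powM_eq_pow h z _)⟩

end Models

lemma powM_real (x : ℝ) : ∀ k, powM x k = x ^ k
  | 0 => by rw [pow_zero]; rfl
  | 1 => by rw [pow_one]; rfl
  | k + 2 => by rw [pow_succ, ← powM_real x (k + 1)]; rfl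

lemma exists_odd_root (n : ℕ) (x : ℝ) : ∃ y, x = y ^ (2 * n + 1) := by
  have hn : 2 * n + 1 ≠ 0 := by lia
  rcases le_total 0 x with hx | hx
  · exact ⟨x ^ ((2 * n + 1 : ℕ) : ℝ)⁻¹, (Real.rpow_inv_natCast_pow hx hn).symm⟩
  · refine ⟨-(-x) ^ ((2 * n + 1 : ℕ) : ℝ)⁻¹, ?_⟩
    rw [Odd.neg_pow ⟨n, rfl⟩, Real.rpow_inv_natCast_pow (neg_nonneg.2 hx) hn, neg_neg]

instance real_model : ℝ ⊨ realTheory := by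
  rw [model_realTheory_iff, realize_axO1, realize_axO2, realize_axO3, realize_axM1, realize_axM2,
    realize_axM3, realize_axM4, realize_axM5pos, realize_axM5neg, realize_axM6, realize_axM9]
  simp only [realize_axM7, realize_axM8, powM_real]
  refine ⟨⟨?_, ?_, ?_, ?_, ?_, ?_, ?_, ?_, ?_, ?_, ?_⟩, ?_, ?_⟩
  · exact fun x y (h : x < y) => h.not_gt
  · exact fun x y z (h : x < y) (h' : y < z) => h.trans h'
  · exact fun x y => lt_trichotomy x y
  · exact fun x y z => (mul_assoc x y z).symm
  · exact fun x => ⟨mul_one x, mul_zero x, inv_zero.symm⟩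
  · exact fun x (hx : x ≠ 0) => mul_inv_cancel₀ hx
  · exact fun x y => mul_comm x y
  · exact fun x y z (h : x < y) (h' : 0 < z) => mul_lt_mul_of_pos_right h h'
  · exact fun x y z (h : x < y) (h' : z < 0) => mul_lt_mul_of_neg_right h h'
  · exact ⟨(2 : ℝ), neg_one_lt_zero, one_pos, one_lt_two⟩
  · intro x
    change 0 < x ↔ ∃ y : ℝ, y ≠ 0 ∧ x = y ^ 2
    constructor
    · exact fun hx => ⟨√x, (Real.sqrt_pos.2 hx).ne', (Real.sq_sqrt hx.le).symm⟩
    · rintro ⟨y, hy, rfl⟩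
      positivity
  · exact exists_odd_root
  · intro n hn x
    change x ^ (2 * n) = 1 ↔ (x = 1 ∨ x = -1)
    rw [pow_mul, pow_eq_one_iff_of_nonneg (sq_nonneg x) (by lia), sq_eq_one_iff]

/-- Every model of the axioms is elementarily equivalent to the reals. -/
theorem realize_sentence_iff {M : Type} [Lang.Structure M] (h : M ⊨ realTheory)
    (φ : Lang.Sentence) : M ⊨ φ ↔ ℝ ⊨ φ := by
  obtain ⟨G, _, _, _, u, hu, hG, ⟨C⟩⟩ := exists_coordinates h
  -- Empty tuples are similar up to any bound: there are no signs, and every form is an empty sum.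
  exact C.realize_iff_of_similar realCoordinates hu one_pos hG exists_eq_nsmul_real φ _ _ _ _
    ⟨fun i => i.elim0, fun c _ => by simp [linForm]⟩

theorem realTheory_models_iff (φ : Lang.Sentence) : realTheory ⊨ᵇ φ ↔ ℝ ⊨ φ := by
  rw [Theory.models_sentence_iff]
  exact ⟨fun h => h (Theory.ModelType.of realTheory ℝ),
    fun h M => (realize_sentence_iff M.is_model φ).2 h⟩

/-- Translating a sentence of the small language along `incl` therefore preserves its truth in the
reals, and the claim about `{<, ×}` becomes a special case. -/
instance : incl.IsExpansionOn ℝ where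
  map_onFunction := fun f v => by cases f; rfl
  map_onRelation := fun r v => by cases r; rfl

theorem realTheory_models_base_iff (φ : BaseLang.Sentence) :
    realTheory ⊨ᵇ incl.onSentence φ ↔ ℝ ⊨ φ := by
  rw [realTheory_models_iff, LHom.realize_onSentence]

end OrdMul

namespace OrdMul

/-! ### Quantifier elimination. -/

section Definability

variable {α : Type}

/-- A predicate on real assignments that a quantifier-free formula defines. -/
def QFDefinable (P : (α → ℝ) → Prop) : Prop :=
  ∃ ψ : Lang.Formula α, BoundedFormula.IsQF ψ ∧ ∀ v : α → ℝ, ψ.Realize v ↔ P v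

lemma QFDefinable.not {P : (α → ℝ) → Prop} (h : QFDefinable P) : QFDefinable fun v => ¬ P v := by
  obtain ⟨ψ, hψ, hP⟩ := h
  exact ⟨ψ.not, hψ.not, fun v => by rw [Formula.realize_not, hP]⟩

lemma QFDefinable.and {P Q : (α → ℝ) → Prop} (h : QFDefinable P) (h' : QFDefinable Q) :
    QFDefinable fun v => P v ∧ Q v := by
  obtain ⟨ψ, hψ, hP⟩ := h
  obtain ⟨χ, hχ, hQ⟩ := h'
  exact ⟨ψ ⊓ χ, hψ.inf hχ, fun v => by rw [Formula.realize_inf, hP, hQ]⟩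

lemma QFDefinable.true : QFDefinable fun _ : α → ℝ => True :=
  ⟨⊤, BoundedFormula.IsQF.top, fun v => by simp⟩

lemma QFDefinable.finset_forall {ι : Type} (s : Finset ι) {P : ι → (α → ℝ) → Prop}
    (h : ∀ i, QFDefinable (P i)) : QFDefinable fun v => ∀ i ∈ s, P i v := by
  classical
  induction s using Finset.induction_on with
  | empty => simpa using QFDefinable.true
  | insert i s _ ih => simpa only [Finset.forall_mem_insert] using (h i).and ih

lemma QFDefinable.finset_exists {ι : Type} (s : Finset ι) {P : ι → (α → ℝ) → Prop}
    (h : ∀ i, QFDefinable (P i)) : QFDefinable fun v => ∃ i ∈ s, P i v := by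
  simpa using (QFDefinable.finset_forall s fun i => (h i).not).not

/-- A predicate that is determined by finitely many definable ones is definable. -/
lemma QFDefinable.of_finite {ι : Type} [Finite ι] {P : ι → (α → ℝ) → Prop}
    (h : ∀ i, QFDefinable (P i)) {Q : (α → ℝ) → Prop}
    (hQ : ∀ v w, (∀ i, P i v ↔ P i w) → Q v → Q w) : QFDefinable Q := by
  classical
  have := Fintype.ofFinite ι
  -- `T` consists of the truth patterns realised by some assignment in `Q`. The predicate `Q` is the
  -- disjunction over `T` of the conjunctions that prescribe such a pattern completely.
  let T : Finset (Finset ι) :=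
    Finset.univ.filter fun S => ∃ w, Q w ∧ ∀ i, P i w ↔ i ∈ S
  have key : QFDefinable fun v => ∃ S ∈ T, ∀ i ∈ (Finset.univ : Finset ι),
      (if i ∈ S then P i v else ¬ P i v) := by
    refine QFDefinable.finset_exists T fun S => QFDefinable.finset_forall _ fun i => ?_
    split_ifs
    · exact h i
    · exact (h i).not
  obtain ⟨ψ, hψ, hP⟩ := key
  refine ⟨ψ, hψ, fun v => (hP v).trans ⟨?_, fun hv => ?_⟩⟩
  · rintro ⟨S, hS, hv⟩
    obtain ⟨w, hw, hwS⟩ := (Finset.mem_filter.1 hS).2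
    refine hQ w v (fun i => ?_) hw
    have := hv i (Finset.mem_univ i)
    rw [hwS]
    split_ifs at this with hi <;> simp [hi, this]
  · refine ⟨Finset.univ.filter fun i => P i v, Finset.mem_filter.2 ⟨Finset.mem_univ _, v, hv,
      fun i => by simp⟩, fun i _ => ?_⟩
    by_cases hi : P i v <;> simp [hi]

/-- A real function that a term defines. -/
def TermDefinable (f : (α → ℝ) → ℝ) : Prop := ∃ t : Lang.Term α, ∀ v : α → ℝ, t.realize v = f v

lemma TermDefinable.var (a : α) : TermDefinable fun v : α → ℝ => v a := ⟨Term.var a, fun _ => rfl⟩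

lemma TermDefinable.zero : TermDefinable fun _ : α → ℝ => 0 := ⟨tZero, fun _ => realize_tZero _⟩

lemma TermDefinable.one : TermDefinable fun _ : α → ℝ => 1 := ⟨tOne, fun _ => realize_tOne _⟩

lemma TermDefinable.mul {f g : (α → ℝ) → ℝ} (hf : TermDefinable f) (hg : TermDefinable g) :
    TermDefinable fun v => f v * g v := by
  obtain ⟨s, hs⟩ := hf
  obtain ⟨t, ht⟩ := hg
  exact ⟨tMul s t, fun v => by rw [realize_tMul, hs, ht]; rfl⟩

lemma TermDefinable.inv {f : (α → ℝ) → ℝ} (hf : TermDefinable f) :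
    TermDefinable fun v => (f v)⁻¹ := by
  obtain ⟨s, hs⟩ := hf
  exact ⟨tInv s, fun v => by rw [realize_tInv, hs]; rfl⟩

lemma TermDefinable.neg {f : (α → ℝ) → ℝ} (hf : TermDefinable f) :
    TermDefinable fun v => - f v := by
  obtain ⟨s, hs⟩ := hf
  exact ⟨tMul tNegOne s, fun v => by
    rw [realize_tMul, realize_tNegOne, hs]
    exact neg_one_mul _⟩

lemma TermDefinable.pow {f : (α → ℝ) → ℝ} (hf : TermDefinable f) (k : ℕ) :
    TermDefinable fun v => f v ^ k := by
  obtain ⟨s, hs⟩ := hf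
  exact ⟨tPow s k, fun v => by rw [realize_tPow, hs, powM_real]⟩

lemma TermDefinable.zpow {f : (α → ℝ) → ℝ} (hf : TermDefinable f) :
    ∀ k : ℤ, TermDefinable fun v => f v ^ k
  | Int.ofNat k => by simpa using hf.pow k
  | Int.negSucc k => by simpa only [zpow_negSucc] using (hf.pow (k + 1)).inv

lemma TermDefinable.prod {ι : Type} (s : Finset ι) {f : ι → (α → ℝ) → ℝ}
    (h : ∀ i, TermDefinable (f i)) : TermDefinable fun v => ∏ i ∈ s, f i v := by
  classical
  induction s using Finset.induction_on with
  | empty => simpa using TermDefinable.one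
  | insert i s hi ih => simpa only [Finset.prod_insert hi] using (h i).mul ih

lemma TermDefinable.lt {f g : (α → ℝ) → ℝ} (hf : TermDefinable f) (hg : TermDefinable g) :
    QFDefinable fun v => f v < g v := by
  obtain ⟨s, hs⟩ := hf
  obtain ⟨t, ht⟩ := hg
  refine ⟨fLt (s.relabel Sum.inl) (t.relabel Sum.inl),
    (BoundedFormula.IsAtomic.rel _ _).isQF, fun v => ?_⟩
  rw [Formula.Realize, realize_fLt, Term.realize_relabel, Term.realize_relabel, Sum.elim_comp_inl,
    hs, ht]
  rfl

end Definability

/-- `s * x`, or `1` if the sign `s` is zero. -/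
def signMul (s : SignType) (x : ℝ) : ℝ :=
  match s with
  | .zero => 1
  | .neg => -x
  | .pos => x

lemma signMul_sign_pos (x : ℝ) : 0 < signMul (SignType.sign x) x := by
  rcases lt_trichotomy x 0 with hx | rfl | hx
  · rw [sign_neg hx]
    exact neg_pos.2 hx
  · rw [sign_zero]
    exact one_pos
  · rw [sign_pos hx]
    exact hx

/-- At zero both sides vanish: `signMul` has the value `1` there, and `Real.log 0 = 0` by
convention. -/
lemma log_signMul_sign (x : ℝ) : Real.log (signMul (SignType.sign x) x) = Real.log |x| := by
  rcases lt_trichotomy x 0 with hx | rfl | hx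
  · rw [sign_neg hx, abs_of_neg hx]
    rfl
  · rw [sign_zero, abs_zero, Real.log_zero]
    exact Real.log_one
  · rw [sign_pos hx, abs_of_pos hx]
    rfl

/-- Exponentiation turns the form into a product of integer powers. Once the signs are fixed, the
absolute values of nonzero factors are `x i` or `-x i`, so the product is the value of a term and
the condition is atomic. -/
lemma linForm_log_pos_iff {m : ℕ} (c : Fin m → ℤ) (x : Fin m → ℝ) :
    0 < linForm c (fun i => Real.log |x i|) ↔
      1 < ∏ i, signMul (SignType.sign (x i)) (x i) ^ c i := by
  have hpos : ∀ i, 0 < signMul (SignType.sign (x i)) (x i) ^ c i := fun i =>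
    zpow_pos (signMul_sign_pos _) _
  rw [← Real.log_pos_iff (Finset.prod_pos fun i _ => hpos i).le,
    Real.log_prod fun i _ => (hpos i).ne']
  simp only [Real.log_zpow, log_signMul_sign, linForm, zsmul_eq_mul]

/-- Quantifier elimination for the reals with order and multiplication. -/
theorem hasQE_real : HasQE Lang ℝ := by
  classical
  intro α φ
  -- The index type `α` may be infinite, but only the finitely many free variables of `φ` matter;
  -- they are renumbered by `Fin m`.
  set m := φ.freeVarFinset.card with hm
  let e : φ.freeVarFinset ≃ Fin m := φ.freeVarFinset.equivFin
  let φ' : Lang.BoundedFormula Empty m :=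
    (φ.restrictFreeVar e).relabel (n := m) (k := 0) (Sum.inr : Fin m → Empty ⊕ Fin m)
  have hφ' : ∀ (v : α → ℝ) (d : Empty → ℝ),
      φ'.Realize d (fun i => v (e.symm i)) ↔ φ.Realize v := by
    intro v d
    rw [Formula.Realize, BoundedFormula.realize_relabel]
    refine (BoundedFormula.realize_restrictFreeVar v fun a => ?_).trans
      (iff_of_eq (congrArg _ (Subsingleton.elim _ _)))
    simp
  set A := coefBound (code φ' + 2) (code φ')
  -- Finitely many conditions that determine the similarity class: the signs, and for every sign
  -- pattern `s` and every coefficient vector up to `A` one inequality. Only the inequalities for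
  -- the actual sign pattern are significant, but which pattern that is depends on the assignment.
  let P : (Fin m × Bool) ⊕ ((Fin m → SignType) × (Fin m → Finset.Icc (-(A : ℤ)) A)) →
      (α → ℝ) → Prop := fun j v => match j with
    | Sum.inl (i, true) => 0 < v (e.symm i)
    | Sum.inl (i, false) => v (e.symm i) < 0
    | Sum.inr (s, c) => 1 < ∏ i, signMul (s i) (v (e.symm i)) ^ (c i : ℤ)
  suffices H : QFDefinable fun v : α → ℝ => φ.Realize v by
    obtain ⟨ψ, hψ, h⟩ := H
    exact ⟨ψ, hψ, fun v => (h v).symm⟩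
  refine QFDefinable.of_finite (P := P) ?_ ?_
  · rintro (⟨i, _ | _⟩ | ⟨s, c⟩)
    · exact (TermDefinable.var _).lt TermDefinable.zero
    · exact TermDefinable.zero.lt (TermDefinable.var _)
    · refine TermDefinable.one.lt (TermDefinable.prod _ fun i => TermDefinable.zpow ?_ _)
      rcases s i with _ | _ | _
      · exact TermDefinable.one
      · exact (TermDefinable.var _).neg
      · exact TermDefinable.var _
  · intro v w hvw hv
    rw [← hφ' v Empty.elim] at hv
    rw [← hφ' w Empty.elim]
    have hsign : ∀ i, SignType.sign (v (e.symm i)) = SignType.sign (w (e.symm i)) := by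
      intro i
      have h1 : 0 < v (e.symm i) ↔ 0 < w (e.symm i) := hvw (Sum.inl (i, true))
      have h2 : v (e.symm i) < 0 ↔ w (e.symm i) < 0 := hvw (Sum.inl (i, false))
      simp only [sign_apply, h1, h2]
    refine (realCoordinates.realize_iff_of_similar realCoordinates one_pos one_pos
      exists_eq_nsmul_real exists_eq_nsmul_real φ' _ _ _ _ ⟨hsign, fun c hc => ?_⟩).1 hv
    change 0 < linForm c (fun i => Real.log |v (e.symm i)|) ↔
      0 < linForm c (fun i => Real.log |w (e.symm i)|)
    rw [linForm_log_pos_iff, linForm_log_pos_iff]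
    simp only [← hsign]
    exact hvw (Sum.inr (fun i => SignType.sign (v (e.symm i)),
      fun i => ⟨c i, Finset.mem_Icc.2 (abs_le.1 (hc i))⟩))

/-! ### Infinitely many axioms. -/

section Infinite

/-- Each further factor enlarges the code. Exponents start at `1` because `tPow t 0` is the constant
`1`, whose code need not lie below that of `t`. -/
lemma codeTerm_tPow_strictMono {n : ℕ} (t : Lang.Term (Empty ⊕ Fin n)) :
    StrictMono fun k => codeTerm (tPow t (k + 1)) :=
  strictMono_nat_of_lt_succ fun k => by
    have h1 := Nat.add_le_pair 5 (Nat.pair (codeTerm (tPow t (k + 1))) (codeTerm t))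
    have h2 := Nat.add_le_pair (codeTerm (tPow t (k + 1))) (codeTerm t)
    simp only [tPow, tMul, codeTerm, Matrix.cons_val_zero, Matrix.cons_val_one]
    lia

lemma axM7_injective : Function.Injective axM7 := by
  intro m n h
  unfold axM7 at h
  have h1 := congrArg code h
  simp only [Term.bdEqual, code, Nat.pair_eq_pair,
    true_and, and_true] at h1
  have := (codeTerm_tPow_strictMono _).injective h1
  lia

lemma realTheory_infinite : realTheory.Infinite :=
  (Set.infinite_range_of_injective axM7_injective).mono (by
    rintro _ ⟨n, rfl⟩
    exact Or.inl (Or.inr ⟨n, rfl⟩))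

end Infinite

end OrdMul

namespace OrdMul

/-! ### Integer logarithms in finite ranges. -/

section Integers

/-- The logarithms chosen with `r` more quantifiers to come are multiples of `modulus K r`. -/
def modulus (K : ℕ) : ℕ → ℕ
  | 0 => 1
  | r + 1 => 2 * (coefBound K r).factorial * modulus K r

lemma modulus_pos (K r : ℕ) : 0 < modulus K r := by
  induction r with
  | zero => exact one_pos
  | succ r ih =>
    rw [modulus]
    have := (coefBound K r).factorial_pos
    positivity

lemma modulus_dvd {K r s : ℕ} (h : r ≤ s) : modulus K r ∣ modulus K s := by
  induction s, h using Nat.le_induction with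
  | base => exact dvd_rfl
  | succ s _ ih => exact ih.trans (Dvd.intro_left _ rfl)

/-- The factor by which the bounds of the quantifiers grow. -/
def growth (p : ℕ) : ℕ := p * coefBound (p + 2) p * modulus (p + 2) p + 1

/-- The range of the `n`-th quantifier, for sentences with code `p`. -/
def intRange (p n : ℕ) : Set ℤ :=
  {z | ∃ w : ℤ, |w| ≤ growth p ^ (n + 1) ∧ z = modulus (p + 2) (p - (n + 1)) * w}

open Nat in
lemma rich_intRange (p : ℕ) :
    Rich (intRange p) (fun n => coefBound (p + 2) (p - n)) p := by
  intro n hn g hg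
  simp only
  set r := p - (n + 1) with hr
  set A := coefBound (p + 2) r
  set B : ℤ := coefBound (p + 2) p * modulus (p + 2) p * growth p ^ n with hB
  have hN : (0 : ℤ) < modulus (p + 2) r := by exact_mod_cast modulus_pos _ _
  have hL : (0 : ℤ) < A ! := by exact_mod_cast A.factorial_pos
  have hAle : (A : ℤ) ≤ coefBound (p + 2) p := by exact_mod_cast coefBound_mono _ (by lia)
  have hg' : ∀ i, ∃ q : ℤ, g i = (2 * (A ! : ℤ)) * (modulus (p + 2) r * q) ∧
      2 * (A ! : ℤ) * |q| ≤ modulus (p + 2) p * growth p ^ n := by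
    intro i
    obtain ⟨w, hw, hgw⟩ := hg i
    -- Since `i < n < p`, the entry `i` was chosen with at least `r + 1` quantifiers to come; its
    -- divisor `modulus (p + 2) (r + 1)` is exactly `2 * A !` times the modulus required now.
    have hdvd : modulus (p + 2) (r + 1) ∣ modulus (p + 2) (p - ((i : ℕ) + 1)) :=
      modulus_dvd (by lia)
    obtain ⟨c, hc⟩ := hdvd
    have hgi : g i = (2 * (A ! : ℤ)) * (modulus (p + 2) r * (c * w)) := by
      rw [hgw, hc, modulus]
      push_cast
      ring
    refine ⟨c * w, hgi, ?_⟩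
    have h1 : |g i| ≤ modulus (p + 2) p * growth p ^ n := by
      rw [hgw, abs_mul, abs_of_nonneg (by positivity)]
      refine mul_le_mul ?_ (hw.trans ?_) (abs_nonneg _) (by positivity)
      · exact_mod_cast Nat.le_of_dvd (modulus_pos _ _) (modulus_dvd (by lia))
      · exact_mod_cast Nat.pow_le_pow_right (by rw [growth]; lia) (by lia)
    refine le_trans ?_ h1
    rw [hgi, abs_mul (2 * (A ! : ℤ)), abs_mul (modulus (p + 2) r : ℤ),
      abs_of_pos (by positivity : (0 : ℤ) < 2 * A !), abs_of_pos hN]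
    refine mul_le_mul_of_nonneg_left ?_ (by positivity)
    exact le_mul_of_one_le_left (abs_nonneg _) hN
  choose q hq1 hq2 using hg'
  -- The divided tuple consists of multiples of the modulus, and `u` is the modulus itself, so all
  -- combinations are again multiples of it.
  refine ⟨fun i => modulus (p + 2) r * q i, modulus (p + 2) r, hN, fun i => ?_, ?_⟩
  · rw [hq1, smul_eq_mul]
  · intro a ε ha hε
    refine ⟨∑ i, a i * q i + ε, ?_, ?_⟩
    · have h1 : ∀ i, |a i * q i| ≤ B := by
        intro i
        calc |a i * q i| = |a i| * |q i| := abs_mul _ _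
          _ ≤ 2 * (A ! : ℤ) * A * |q i| := mul_le_mul_of_nonneg_right (ha i) (abs_nonneg _)
          _ = A * (2 * (A ! : ℤ) * |q i|) := by ring
          _ ≤ coefBound (p + 2) p * (modulus (p + 2) p * growth p ^ n) :=
            mul_le_mul hAle (hq2 i) (by positivity) (by positivity)
          _ = B := by rw [hB]; ring
      have h2 : |∑ i, a i * q i| ≤ n * B := by
        refine (Finset.abs_sum_le_sum_abs _ _).trans ?_
        simpa using Finset.sum_le_sum fun i (_ : i ∈ Finset.univ) => h1 i
      have h3 : (n : ℤ) * B ≤ p * B := by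
        have : (0 : ℤ) ≤ B := by positivity
        exact mul_le_mul_of_nonneg_right (by exact_mod_cast hn.le) this
      have h4 : (1 : ℤ) ≤ growth p ^ n := by
        exact_mod_cast Nat.one_le_pow _ _ (by rw [growth]; lia)
      -- The definition of `growth` is made for this identity: at most `p` summands bounded by `B`,
      -- and room for `|ε| ≤ 1 ≤ growth p ^ n`.
      have h5 : (growth p : ℤ) ^ (n + 1) = p * B + growth p ^ n := by
        rw [pow_succ, hB]
        conv_lhs => rw [growth]
        conv_rhs => rw [growth]
        push_cast
        ring
      calc |∑ i, a i * q i + ε| ≤ |∑ i, a i * q i| + |ε| := abs_add_le _ _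
        _ ≤ growth p ^ (n + 1) := by rw [h5]; linarith
    · simp only [linForm, smul_eq_mul, mul_add, Finset.mul_sum]
      congr 1
      · exact Finset.sum_congr rfl fun i _ => by ring
      · ring

/-- A sentence holds in the reals if and only if it holds with integer logarithms, chosen from
finite ranges. -/
theorem real_models_iff_sat (φ : Lang.Sentence) :
    ℝ ⊨ φ ↔ Sat (intRange (code φ)) φ (fun i : Fin 0 => i.elim0) := by
  have h : ℝ ⊨ φ ↔ Sat (fun _ => Set.univ) φ (fun i : Fin 0 => i.elim0 : Fin 0 → SignType × ℝ) :=
    realCoordinates.realize_iff _ φ fun i => i.elim0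
  rw [h]
  exact sat_iff_of_similar (Q := code φ) (K := code φ + 2)
    (rich_univ one_pos exists_eq_nsmul_real _ _) (rich_intRange _)
    (fun m hm => (coefBound_sub hm).le) (fun m _ => le_coefBound _ _) φ _ _
    (fun i => i.elim0) (fun i => i.elim0) le_rfl (by lia)
    ⟨fun i => i.elim0, fun c _ => by simp [linForm]⟩

end Integers

end OrdMul

namespace OrdMul

/-! ### Primitive recursive course-of-values recursion. -/

section StrongRecursion

variable {α σ : Type}

/-- The first `n` values of a function defined by course-of-values recursion. -/
def history (step : α → List (Option σ) → Option σ) (a : α) : ℕ → List (Option σ)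
  | 0 => []
  | n + 1 => history step a n ++ [step a (history step a n)]

/-- Course-of-values recursion. -/
def courseRec (step : α → List (Option σ) → Option σ) (a : α) (n : ℕ) : Option σ :=
  step a (history step a n)

/-- The `j`-th entry of a list of optional values. -/
def lookup (l : List (Option σ)) (j : ℕ) : Option σ := l[j]?.bind id

lemma length_history (step : α → List (Option σ) → Option σ) (a : α) (n : ℕ) :
    (history step a n).length = n := by
  induction n with
  | zero => rfl
  | succ n ih => rw [history, List.length_append, ih]; rfl

lemma lookup_history (step : α → List (Option σ) → Option σ) (a : α) {n j : ℕ} (h : j < n) :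
    lookup (history step a n) j = courseRec step a j := by
  induction n with
  | zero => lia
  | succ n ih =>
    rw [lookup, history]
    rcases (Nat.lt_succ_iff.1 h).eq_or_lt with rfl | h
    · rw [List.getElem?_append_right (by rw [length_history]), length_history, Nat.sub_self]
      rfl
    · rw [List.getElem?_append_left (by rwa [length_history])]
      exact ih h

variable [Primcodable α] [Primcodable σ]

/-- The table grows by one entry at a time, so ordinary recursion with lists as values suffices;
`step` can read the current argument off the length of the list. -/
lemma primrec_history {step : α → List (Option σ) → Option σ} (h : Primrec₂ step) :
    Primrec₂ (history step) := by
  refine (Primrec.nat_rec (f := fun _ : α => ([] : List (Option σ)))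
    (g := fun a (q : ℕ × List (Option σ)) => q.2 ++ [step a q.2]) (Primrec.const []) ?_).of_eq ?_
  · exact Primrec.list_concat.comp (Primrec.snd.comp Primrec.snd)
      (h.comp Primrec.fst (Primrec.snd.comp Primrec.snd))
  · intro a n
    induction n with
    | zero => rfl
    | succ n ih => simp only [history, ← ih]

lemma primrec_courseRec {step : α → List (Option σ) → Option σ} (h : Primrec₂ step) :
    Primrec₂ (courseRec step) :=
  h.comp Primrec.fst (primrec_history h)

lemma primrec_lookup : Primrec₂ (lookup (σ := σ)) :=
  Primrec.option_bind Primrec.list_getElem? Primrec.snd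

end StrongRecursion

/-! ### Signs and integers represented by natural numbers. -/

section Numerals

/-- A sign, given modulo three. -/
def toSign (s : ℕ) : SignType := if s % 3 = 0 then 0 else if s % 3 = 1 then 1 else -1

/-- A triple of natural numbers represents a sign and an integer. -/
def decodeVal (x : ℕ × ℕ × ℕ) : SignType × ℤ := (toSign x.1, (x.2.1 : ℤ) - x.2.2)

/-- Equality of the represented elements. -/
def eqVal (x y : ℕ × ℕ × ℕ) : Bool :=
  decide (x.1 % 3 = y.1 % 3 ∧ (x.1 % 3 = 0 ∨ x.2.1 + y.2.2 = y.2.1 + x.2.2))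

/-- Order of the represented elements. -/
def ltVal (x y : ℕ × ℕ × ℕ) : Bool :=
  decide ((x.1 + 1) % 3 < (y.1 + 1) % 3 ∨ (x.1 % 3 = y.1 % 3 ∧
    ((x.1 % 3 = 1 ∧ x.2.1 + y.2.2 < y.2.1 + x.2.2) ∨
      (x.1 % 3 = 2 ∧ y.2.1 + x.2.2 < x.2.1 + y.2.2))))

/-- Product of the represented elements. -/
def mulVal (x y : ℕ × ℕ × ℕ) : ℕ × ℕ × ℕ := (x.1 * y.1, x.2.1 + y.2.1, x.2.2 + y.2.2)

/-- Inverse of the represented element. -/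
def invVal (x : ℕ × ℕ × ℕ) : ℕ × ℕ × ℕ := (x.1, x.2.2, x.2.1)

lemma toSign_eq (s : ℕ) : (s % 3 = 0 ∧ toSign s = 0) ∨ (s % 3 = 1 ∧ toSign s = 1) ∨
    (s % 3 = 2 ∧ toSign s = -1) := by
  have : s % 3 < 3 := Nat.mod_lt _ (by norm_num)
  unfold toSign
  split_ifs with h0 h1
  · exact Or.inl ⟨h0, rfl⟩
  · exact Or.inr (Or.inl ⟨h1, rfl⟩)
  · exact Or.inr (Or.inr ⟨by lia, rfl⟩)

/-- The residues `0`, `1`, `2` modulo three multiply like `0`, `1`, `-1`, so representatives of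
signs may be multiplied without reduction. -/
lemma toSign_mul (s t : ℕ) : toSign (s * t) = toSign s * toSign t := by
  have h : (s * t) % 3 = (s % 3) * (t % 3) % 3 := Nat.mul_mod _ _ _
  rcases toSign_eq s with ⟨h1, e1⟩ | ⟨h1, e1⟩ | ⟨h1, e1⟩ <;>
    rcases toSign_eq t with ⟨h2, e2⟩ | ⟨h2, e2⟩ | ⟨h2, e2⟩ <;>
      rw [e1, e2, toSign, h, h1, h2] <;> rfl

lemma decodeVal_mul (x y : ℕ × ℕ × ℕ) : decodeVal (mulVal x y) =
    ((decodeVal x).1 * (decodeVal y).1, (decodeVal x).2 + (decodeVal y).2) := by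
  simp only [decodeVal, mulVal, toSign_mul, Prod.mk.injEq, true_and]
  push_cast
  ring

lemma decodeVal_inv (x : ℕ × ℕ × ℕ) :
    decodeVal (invVal x) = ((decodeVal x).1, -(decodeVal x).2) := by
  simp [decodeVal, invVal]

lemma eqVal_iff (x y : ℕ × ℕ × ℕ) : eqVal x y = true ↔ ValEq (decodeVal x) (decodeVal y) := by
  have h : ((x.2.1 : ℤ) - x.2.2 = y.2.1 - y.2.2) ↔ x.2.1 + y.2.2 = y.2.1 + x.2.2 := by lia
  simp only [eqVal, ValEq, decodeVal, decide_eq_true_eq, h]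
  rcases toSign_eq x.1 with ⟨h1, e1⟩ | ⟨h1, e1⟩ | ⟨h1, e1⟩ <;>
    rcases toSign_eq y.1 with ⟨h2, e2⟩ | ⟨h2, e2⟩ | ⟨h2, e2⟩ <;>
      simp [h1, e1, h2, e2]

/-- Adding one modulo three sends the residues of `-1`, `0`, `1` to `0`, `1`, `2`, in the right
order. Differences are compared by moving the subtrahends to the other side. -/
lemma ltVal_iff (x y : ℕ × ℕ × ℕ) : ltVal x y = true ↔ ValLT (decodeVal x) (decodeVal y) := by
  have h : ((x.2.1 : ℤ) - x.2.2 < y.2.1 - y.2.2) ↔ x.2.1 + y.2.2 < y.2.1 + x.2.2 := by lia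
  have h' : ((y.2.1 : ℤ) - y.2.2 < x.2.1 - x.2.2) ↔ y.2.1 + x.2.2 < x.2.1 + y.2.2 := by lia
  have hx := Nat.add_mod x.1 1 3
  have hy := Nat.add_mod y.1 1 3
  simp only [ltVal, ValLT, decodeVal, decide_eq_true_eq, h, h', hx, hy]
  rcases toSign_eq x.1 with ⟨h1, e1⟩ | ⟨h1, e1⟩ | ⟨h1, e1⟩ <;>
    rcases toSign_eq y.1 with ⟨h2, e2⟩ | ⟨h2, e2⟩ | ⟨h2, e2⟩ <;>
      simp [h1, e1, h2, e2]

lemma primrec_mod_three {α : Type} [Primcodable α] {f : α → ℕ} (hf : Primrec f) :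
    Primrec fun a => f a % 3 := Primrec.nat_mod.comp hf (Primrec.const 3)

lemma primrec_mulVal : Primrec₂ mulVal := by
  have hx : Primrec fun q : (ℕ × ℕ × ℕ) × (ℕ × ℕ × ℕ) => q.1 := Primrec.fst
  have hy : Primrec fun q : (ℕ × ℕ × ℕ) × (ℕ × ℕ × ℕ) => q.2 := Primrec.snd
  have h21 : Primrec fun x : ℕ × ℕ × ℕ => x.2.1 := Primrec.fst.comp Primrec.snd
  have h22 : Primrec fun x : ℕ × ℕ × ℕ => x.2.2 := Primrec.snd.comp Primrec.snd
  exact (Primrec.nat_mul.comp (Primrec.fst.comp hx) (Primrec.fst.comp hy)).pair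
    ((Primrec.nat_add.comp (h21.comp hx) (h21.comp hy)).pair
      (Primrec.nat_add.comp (h22.comp hx) (h22.comp hy)))

lemma primrec_invVal : Primrec invVal :=
  Primrec.fst.pair ((Primrec.snd.comp Primrec.snd).pair (Primrec.fst.comp Primrec.snd))

lemma primrec_eqVal : Primrec₂ eqVal := by
  have hx : Primrec fun q : (ℕ × ℕ × ℕ) × (ℕ × ℕ × ℕ) => q.1 := Primrec.fst
  have hy : Primrec fun q : (ℕ × ℕ × ℕ) × (ℕ × ℕ × ℕ) => q.2 := Primrec.snd
  have h21 : Primrec fun x : ℕ × ℕ × ℕ => x.2.1 := Primrec.fst.comp Primrec.snd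
  have h22 : Primrec fun x : ℕ × ℕ × ℕ => x.2.2 := Primrec.snd.comp Primrec.snd
  have sx := primrec_mod_three (Primrec.fst.comp hx)
  have sy := primrec_mod_three (Primrec.fst.comp hy)
  exact PrimrecPred.decide ((Primrec.eq.comp sx sy).and
    ((Primrec.eq.comp sx (Primrec.const 0)).or (Primrec.eq.comp
      (Primrec.nat_add.comp (h21.comp hx) (h22.comp hy))
      (Primrec.nat_add.comp (h21.comp hy) (h22.comp hx)))))

lemma primrec_ltVal : Primrec₂ ltVal := by
  have hx : Primrec fun q : (ℕ × ℕ × ℕ) × (ℕ × ℕ × ℕ) => q.1 := Primrec.fst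
  have hy : Primrec fun q : (ℕ × ℕ × ℕ) × (ℕ × ℕ × ℕ) => q.2 := Primrec.snd
  have h21 : Primrec fun x : ℕ × ℕ × ℕ => x.2.1 := Primrec.fst.comp Primrec.snd
  have h22 : Primrec fun x : ℕ × ℕ × ℕ => x.2.2 := Primrec.snd.comp Primrec.snd
  have sx := primrec_mod_three (Primrec.fst.comp hx)
  have sy := primrec_mod_three (Primrec.fst.comp hy)
  have sx' := primrec_mod_three (Primrec.succ.comp (Primrec.fst.comp hx))
  have sy' := primrec_mod_three (Primrec.succ.comp (Primrec.fst.comp hy))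
  have a1 := Primrec.nat_add.comp (h21.comp hx) (h22.comp hy)
  have a2 := Primrec.nat_add.comp (h21.comp hy) (h22.comp hx)
  exact PrimrecPred.decide ((Primrec.nat_lt.comp sx' sy').or ((Primrec.eq.comp sx sy).and
    (((Primrec.eq.comp sx (Primrec.const 1)).and (Primrec.nat_lt.comp a1 a2)).or
      ((Primrec.eq.comp sx (Primrec.const 2)).and (Primrec.nat_lt.comp a2 a1)))))

end Numerals

/-! ### Computability of the bounds and the quantifier ranges. -/

section Arithmetic

lemma primrec_factorial : Primrec Nat.factorial := by
  refine (Primrec.nat_rec₁ 1 (f := fun n m => (n + 1) * m) ?_).of_eq fun n => ?_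
  · exact Primrec.nat_mul.comp (Primrec.succ.comp Primrec.fst) Primrec.snd
  · induction n with
    | zero => rfl
    | succ n ih => rw [Nat.factorial, ← ih]

lemma primrec_pow : Primrec₂ fun a n : ℕ => a ^ n := by
  refine (Primrec.nat_rec (f := fun _ : ℕ => 1) (g := fun a (q : ℕ × ℕ) => q.2 * a)
    (Primrec.const 1) ?_).of_eq fun a n => ?_
  · exact Primrec.nat_mul.comp (Primrec.snd.comp Primrec.snd) Primrec.fst
  · induction n with
    | zero => rfl
    | succ n ih => simp only [pow_succ, ← ih]

lemma primrec_coefBound : Primrec₂ coefBound := by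
  refine (Primrec.nat_rec (f := fun K : ℕ => K) (g := fun _ (q : ℕ × ℕ) => 2 * q.2 ^ 2)
    Primrec.id ?_).of_eq fun K n => ?_
  · exact Primrec.nat_mul.comp (Primrec.const 2)
      (primrec_pow.comp (Primrec.snd.comp Primrec.snd) (Primrec.const 2))
  · induction n with
    | zero => rfl
    | succ n ih => simp only [coefBound, ← ih]

lemma primrec_modulus : Primrec₂ modulus := by
  refine (Primrec.nat_rec (f := fun _ : ℕ => 1)
    (g := fun K (q : ℕ × ℕ) => 2 * (coefBound K q.1).factorial * q.2) (Primrec.const 1) ?_).of_eq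
    fun K n => ?_
  · exact Primrec.nat_mul.comp (Primrec.nat_mul.comp (Primrec.const 2) (primrec_factorial.comp
      (primrec_coefBound.comp Primrec.fst (Primrec.fst.comp Primrec.snd))))
      (Primrec.snd.comp Primrec.snd)
  · induction n with
    | zero => rfl
    | succ n ih => simp only [modulus, ← ih]

lemma primrec_growth : Primrec growth := by
  have h2 : Primrec fun p => p + 2 := Primrec.succ.comp Primrec.succ
  exact Primrec.succ.comp (Primrec.nat_mul.comp (Primrec.nat_mul.comp Primrec.id
    (primrec_coefBound.comp h2 Primrec.id)) (primrec_modulus.comp h2 Primrec.id))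

/-- Representatives of the range of the `n`-th quantifier. -/
def valRange (p n : ℕ) : List (ℕ × ℕ × ℕ) :=
  (List.range 3).flatMap fun s => (List.range (growth p ^ (n + 1) + 1)).flatMap fun a =>
    (List.range (growth p ^ (n + 1) + 1)).map fun b =>
      (s, modulus (p + 2) (p - (n + 1)) * a, modulus (p + 2) (p - (n + 1)) * b)

lemma primrec_valRange : Primrec₂ valRange := by
  have hN : Primrec fun q : ℕ × ℕ => modulus (q.1 + 2) (q.1 - (q.2 + 1)) :=
    primrec_modulus.comp (Primrec.succ.comp (Primrec.succ.comp Primrec.fst))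
      (Primrec.nat_sub.comp Primrec.fst (Primrec.succ.comp Primrec.snd))
  have hW : Primrec fun q : ℕ × ℕ => List.range (growth q.1 ^ (q.2 + 1) + 1) :=
    Primrec.list_range.comp (Primrec.succ.comp (primrec_pow.comp
      (primrec_growth.comp Primrec.fst) (Primrec.succ.comp Primrec.snd)))
  refine Primrec.list_flatMap (Primrec.const _) ?_
  refine Primrec.list_flatMap (hW.comp Primrec.fst) ?_
  refine Primrec.list_map (hW.comp (Primrec.fst.comp Primrec.fst)) ?_
  have h1 : Primrec fun q : (((ℕ × ℕ) × ℕ) × ℕ) × ℕ => q.1.1.1 :=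
    Primrec.fst.comp (Primrec.fst.comp Primrec.fst)
  have h2 : Primrec fun q : (((ℕ × ℕ) × ℕ) × ℕ) × ℕ => q.1.1.2 :=
    Primrec.snd.comp (Primrec.fst.comp Primrec.fst)
  have h3 : Primrec fun q : (((ℕ × ℕ) × ℕ) × ℕ) × ℕ => q.1.2 := Primrec.snd.comp Primrec.fst
  exact h2.pair ((Primrec.nat_mul.comp (hN.comp h1) h3).pair
    (Primrec.nat_mul.comp (hN.comp h1) Primrec.snd))

lemma mem_valRange {p n : ℕ} {x : ℕ × ℕ × ℕ} : x ∈ valRange p n ↔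
    ∃ s < 3, ∃ a ≤ growth p ^ (n + 1), ∃ b ≤ growth p ^ (n + 1),
      (s, modulus (p + 2) (p - (n + 1)) * a, modulus (p + 2) (p - (n + 1)) * b) = x := by
  simp only [valRange, List.mem_flatMap, List.mem_map, List.mem_range, Nat.lt_succ_iff]

lemma exists_mem_valRange (p n : ℕ) : ∃ x, x ∈ valRange p n :=
  ⟨_, mem_valRange.2 ⟨0, by norm_num, 0, Nat.zero_le _, 0, Nat.zero_le _, rfl⟩⟩

lemma exists_toSign (s : SignType) : ∃ k < 3, toSign k = s := by
  rcases s.trichotomy with rfl | rfl | rfl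
  · exact ⟨2, by norm_num, rfl⟩
  · exact ⟨0, by norm_num, rfl⟩
  · exact ⟨1, by norm_num, rfl⟩

/-- The integers of absolute value at most `W` are the differences of natural numbers up to `W`: an
integer `w` is the difference of `w.toNat` and `(-w).toNat`. -/
lemma forall_valRange {p n : ℕ} {P : SignType × ℤ → Prop} :
    (∀ x ∈ valRange p n, P (decodeVal x)) ↔ ∀ s, ∀ g ∈ intRange p n, P (s, g) := by
  constructor
  · rintro h s g ⟨w, hw, rfl⟩
    obtain ⟨k, hk, rfl⟩ := exists_toSign s
    have hw' : |w| ≤ ((growth p ^ (n + 1) : ℕ) : ℤ) := by exact_mod_cast hw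
    rw [abs_le] at hw'
    have := h _ (mem_valRange.2 ⟨k, hk, w.toNat, by lia, (-w).toNat, by lia, rfl⟩)
    convert this using 1
    simp only [decodeVal, Prod.mk.injEq, true_and]
    push_cast
    rw [← mul_sub]
    congr 1
    lia
  · intro h x hx
    obtain ⟨s, -, a, ha, b, hb, rfl⟩ := mem_valRange.1 hx
    refine h _ _ ⟨(a : ℤ) - b, ?_, ?_⟩
    · have : |(a : ℤ) - b| ≤ ((growth p ^ (n + 1) : ℕ) : ℤ) := by rw [abs_le]; lia
      exact_mod_cast this
    · push_cast
      ring

end Arithmetic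

end OrdMul

namespace OrdMul

open Encodable (encode decode)

/-! ### The evaluator and decidability. -/

section Evaluation

/-- One step in the evaluation of a term from its code and the values of the variables, the most
recent variable first. -/
def termStep (env : List (ℕ × ℕ × ℕ)) (l : List (Option (ℕ × ℕ × ℕ))) : Option (ℕ × ℕ × ℕ) :=
  if l.length.unpair.1 = 0 then env.reverse[l.length.unpair.2]?
  else if l.length.unpair.1 = 1 then (if l.length.unpair.2 = 0 then some (2, 0, 0) else none)
  else if l.length.unpair.1 = 2 then (if l.length.unpair.2 = 0 then some (0, 0, 0) else none)
  else if l.length.unpair.1 = 3 then (if l.length.unpair.2 = 0 then some (1, 0, 0) else none)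
  else if l.length.unpair.1 = 4 then (lookup l l.length.unpair.2).map invVal
  else if l.length.unpair.1 = 5 then
    (lookup l l.length.unpair.2.unpair.1).bind fun x =>
      (lookup l l.length.unpair.2.unpair.2).map fun y => mulVal x y
  else none

/-- The value of the term with a given code, if there is one. -/
def termValue : List (ℕ × ℕ × ℕ) → ℕ → Option (ℕ × ℕ × ℕ) := courseRec termStep

lemma primrec_termValue : Primrec₂ termValue := by
  refine primrec_courseRec ?_
  have hl : Primrec fun q : List (ℕ × ℕ × ℕ) × List (Option (ℕ × ℕ × ℕ)) => q.2 := Primrec.snd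
  have hu := Primrec.unpair.comp (Primrec.list_length.comp hl)
  have hc := Primrec.fst.comp hu
  have hr := Primrec.snd.comp hu
  have hr' := Primrec.unpair.comp hr
  have hcase : ∀ i : ℕ, PrimrecPred
      fun q : List (ℕ × ℕ × ℕ) × List (Option (ℕ × ℕ × ℕ)) => q.2.length.unpair.1 = i :=
    fun i => Primrec.eq.comp hc (Primrec.const i)
  have hconst : ∀ x : ℕ × ℕ × ℕ, Primrec
      fun q : List (ℕ × ℕ × ℕ) × List (Option (ℕ × ℕ × ℕ)) =>
        if q.2.length.unpair.2 = 0 then some x else none := fun x =>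
    Primrec.ite (Primrec.eq.comp hr (Primrec.const 0)) (Primrec.const _) (Primrec.const _)
  refine Primrec.ite (hcase 0)
    (Primrec.list_getElem?.comp (Primrec.list_reverse.comp Primrec.fst) hr) ?_
  refine Primrec.ite (hcase 1) (hconst _) ?_
  refine Primrec.ite (hcase 2) (hconst _) ?_
  refine Primrec.ite (hcase 3) (hconst _) ?_
  refine Primrec.ite (hcase 4)
    (Primrec.option_map (primrec_lookup.comp hl hr) (primrec_invVal.comp Primrec.snd)) ?_
  refine Primrec.ite (hcase 5) ?_ (Primrec.const none)
  refine Primrec.option_bind (primrec_lookup.comp hl (Primrec.fst.comp hr')) ?_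
  exact Primrec.option_map ((primrec_lookup.comp hl (Primrec.snd.comp hr')).comp Primrec.fst)
    (primrec_mulVal.comp (Primrec.snd.comp Primrec.fst) Primrec.snd)

lemma lt_pair_right {c r : ℕ} (hc : 0 < c) : r < Nat.pair c r := by
  have := Nat.add_le_pair c r
  lia

lemma termValue_pair (env : List (ℕ × ℕ × ℕ)) (c r : ℕ) : termValue env (Nat.pair c r) =
    if c = 0 then env.reverse[r]?
    else if c = 1 then (if r = 0 then some (2, 0, 0) else none)
    else if c = 2 then (if r = 0 then some (0, 0, 0) else none)
    else if c = 3 then (if r = 0 then some (1, 0, 0) else none)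
    else if c = 4 then (termValue env r).map invVal
    else if c = 5 then
      (termValue env r.unpair.1).bind fun x => (termValue env r.unpair.2).map fun y => mulVal x y
    else none := by
  -- Variables are separated because `Nat.pair 0 r` need not exceed `r`, and the table only contains
  -- the values at smaller codes.
  rcases Nat.eq_zero_or_pos c with rfl | hc
  · simp only [termValue, courseRec, termStep, length_history, Nat.unpair_pair, if_true]
  · have h := lt_pair_right (r := r) hc
    have h1 := (Nat.unpair_left_le r).trans_lt h
    have h2 := (Nat.unpair_right_le r).trans_lt h
    simp only [termValue]
    rw [courseRec, termStep]
    simp only [length_history, Nat.unpair_pair, lookup_history _ _ h, lookup_history _ _ h1,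
      lookup_history _ _ h2]

/-- The assignment that a list of values represents. -/
def listVal (n : ℕ) (env : List (ℕ × ℕ × ℕ)) : Fin n → SignType × ℤ :=
  fun i => decodeVal (env.reverse.getD i (0, 0, 0))

lemma termValue_codeTerm {n : ℕ} {env : List (ℕ × ℕ × ℕ)} (hn : env.length = n) :
    ∀ t : Lang.Term (Empty ⊕ Fin n), ∃ x, termValue env (codeTerm t) = some x ∧
      decodeVal x = termVal t (listVal n env)
  | Term.var (Sum.inr i) => by
    have hi : (i : ℕ) < env.reverse.length := by rw [List.length_reverse, hn]; exact i.2
    refine ⟨env.reverse[(i : ℕ)], ?_, ?_⟩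
    · rw [codeTerm, termValue_pair, if_pos rfl, List.getElem?_eq_getElem hi]
    · rw [termVal_var, listVal, List.getD_eq_getElem _ _ hi]
  | Term.func Func.negOne _ => ⟨(2, 0, 0), by simp [codeTerm, termValue_pair], by
      rw [termVal_negOne]; rfl⟩
  | Term.func Func.zero _ => ⟨(0, 0, 0), by simp [codeTerm, termValue_pair], by
      rw [termVal_zero]; rfl⟩
  | Term.func Func.one _ => ⟨(1, 0, 0), by simp [codeTerm, termValue_pair], by
      rw [termVal_one]; rfl⟩
  | Term.func Func.inv ts => by
    obtain ⟨x, hx, hx'⟩ := termValue_codeTerm hn (ts 0)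
    exact ⟨invVal x, by simp [codeTerm, termValue_pair, hx], by
      rw [termVal_inv, decodeVal_inv, hx']⟩
  | Term.func Func.mul ts => by
    obtain ⟨x, hx, hx'⟩ := termValue_codeTerm hn (ts 0)
    obtain ⟨y, hy, hy'⟩ := termValue_codeTerm hn (ts 1)
    exact ⟨mulVal x y, by simp [codeTerm, termValue_pair, hx, hy], by
      rw [termVal_mul, decodeVal_mul, hx', hy']⟩

/-- A converse to `termValue_codeTerm`: a defined value certifies that the number codes a term, so
evaluation also checks the syntax. -/
lemma exists_codeTerm_eq {n : ℕ} {env : List (ℕ × ℕ × ℕ)} (hn : env.length = n) (k : ℕ) :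
    ∀ x, termValue env k = some x → ∃ t : Lang.Term (Empty ⊕ Fin n), codeTerm t = k := by
  induction k using Nat.strong_induction_on with
  | _ k ih =>
    obtain ⟨c, r, rfl⟩ : ∃ c r, k = Nat.pair c r := ⟨_, _, (Nat.pair_unpair k).symm⟩
    intro x hx
    rw [termValue_pair] at hx
    split_ifs at hx with h0 h1 hr h2 hr h3 hr h4 h5
    · subst h0
      obtain ⟨hi, -⟩ := List.getElem?_eq_some_iff.1 hx
      rw [List.length_reverse, hn] at hi
      exact ⟨Term.var (Sum.inr ⟨r, hi⟩), rfl⟩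
    · exact ⟨tNegOne, by rw [h1, hr]; rfl⟩
    · exact ⟨tZero, by rw [h2, hr]; rfl⟩
    · exact ⟨tOne, by rw [h3, hr]; rfl⟩
    · obtain ⟨y, hy, -⟩ := Option.map_eq_some_iff.1 hx
      obtain ⟨t, rfl⟩ := ih r (lt_pair_right (by lia)) y hy
      exact ⟨tInv t, by rw [h4]; rfl⟩
    · obtain ⟨y, hy, hx⟩ := Option.bind_eq_some_iff.1 hx
      obtain ⟨z, hz, -⟩ := Option.map_eq_some_iff.1 hx
      have h := lt_pair_right (c := c) (r := r) (by lia)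
      obtain ⟨t, ht⟩ := ih _ ((Nat.unpair_left_le r).trans_lt h) y hy
      obtain ⟨u, hu⟩ := ih _ ((Nat.unpair_right_le r).trans_lt h) z hz
      refine ⟨tMul t u, ?_⟩
      rw [h5, ← Nat.pair_unpair r, ← ht, ← hu]
      rfl

/-- Conjunction, undefined unless both arguments are defined. -/
def andOpt (x y : Option Bool) : Option Bool := x.bind fun a => y.map fun b => a && b

/-- There is no short-circuiting: one undefined entry makes the conjunction undefined, even if
another is false. This allows well-formedness to be recovered from definedness. -/
lemma foldr_andOpt {δ : Type} (f : δ → Option Bool) (l : List δ) (b : Bool) :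
    l.foldr (fun d acc => andOpt (f d) acc) (some true) = some b ↔
      (∀ d ∈ l, ∃ a, f d = some a) ∧ (b = true ↔ ∀ d ∈ l, f d = some true) := by
  induction l generalizing b with
  | nil => cases b <;> simp
  | cons d l ih =>
    rw [List.foldr_cons, andOpt]
    constructor
    · intro h
      obtain ⟨a, ha, h⟩ := Option.bind_eq_some_iff.1 h
      obtain ⟨a', ha', rfl⟩ := Option.map_eq_some_iff.1 h
      obtain ⟨h1, h2⟩ := (ih a').1 ha'
      refine ⟨List.forall_mem_cons.2 ⟨⟨a, ha⟩, h1⟩, ?_⟩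
      rw [List.forall_mem_cons, ← h2, ha, Bool.and_eq_true, Option.some_inj]
    · rintro ⟨h1, h2⟩
      obtain ⟨⟨a, ha⟩, h1⟩ := List.forall_mem_cons.1 h1
      have h3 := (ih (decide (∀ d ∈ l, f d = some true))).2 ⟨h1, by simp⟩
      rw [h3, ha]
      rw [List.forall_mem_cons, ha] at h2
      simp only [Option.bind_some, Option.map_some, Option.some_inj] at h2 ⊢
      rw [Bool.eq_iff_iff, h2, Bool.and_eq_true, decide_eq_true_eq]

/-- A bound for the codes of the values that the quantifiers range over. -/
def valBound (p : ℕ) : ℕ :=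
  Nat.pair 2 (Nat.pair (modulus (p + 2) p * growth p ^ p) (modulus (p + 2) p * growth p ^ p))

/-- A bound for the codes of lists of length `n` with entries whose codes are at most `b`. -/
def listBound (b : ℕ) : ℕ → ℕ
  | 0 => 0
  | n + 1 => (Nat.pair b (listBound b n)).succ

/-- A strict bound for the codes of the assignments. -/
def envBound (p : ℕ) : ℕ := listBound (valBound p) p + 1

lemma primrec_envBound : Primrec envBound := by
  have hB : Primrec fun p => modulus (p + 2) p * growth p ^ p :=
    Primrec.nat_mul.comp (primrec_modulus.comp (Primrec.succ.comp Primrec.succ) Primrec.id)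
      (primrec_pow.comp primrec_growth Primrec.id)
  have hV : Primrec valBound :=
    Primrec₂.natPair.comp (Primrec.const 2) (Primrec₂.natPair.comp hB hB)
  have hL : Primrec₂ listBound := by
    refine (Primrec.nat_rec (f := fun _ : ℕ => 0)
      (g := fun b (q : ℕ × ℕ) => (Nat.pair b q.2).succ) (Primrec.const 0) ?_).of_eq fun b n => ?_
    · exact Primrec.succ.comp
        (Primrec₂.natPair.comp Primrec.fst (Primrec.snd.comp Primrec.snd))
    · induction n with
      | zero => rfl
      | succ n ih => simp only [listBound, ← ih]
  exact Primrec.succ.comp (hL.comp hV Primrec.id)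

lemma pair_le_pair {a b c d : ℕ} (h : a ≤ c) (h' : b ≤ d) : Nat.pair a b ≤ Nat.pair c d := by
  have h1 : Nat.pair a b ≤ Nat.pair c b := by
    rcases h.eq_or_lt with rfl | h
    · exact le_rfl
    · exact (Nat.pair_lt_pair_left _ h).le
  have h2 : Nat.pair c b ≤ Nat.pair c d := by
    rcases h'.eq_or_lt with rfl | h'
    · exact le_rfl
    · exact (Nat.pair_lt_pair_right _ h').le
  exact h1.trans h2

lemma listBound_mono (b : ℕ) : Monotone (listBound b) :=
  monotone_nat_of_le_succ fun n => by
    have := Nat.right_le_pair b (listBound b n)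
    rw [listBound]
    lia

/-- The assignments that occur in the evaluation of the sentence with code `p`. -/
def IsEnv (p : ℕ) (env : List (ℕ × ℕ × ℕ)) : Prop :=
  env.length ≤ p ∧ ∀ x ∈ env, encode x ≤ valBound p

lemma IsEnv.encode_lt {p : ℕ} {env : List (ℕ × ℕ × ℕ)} (h : IsEnv p env) :
    encode env < envBound p := by
  refine Nat.lt_succ_of_le (le_trans ?_ (listBound_mono _ h.1))
  obtain ⟨-, h⟩ := h
  induction env with
  | nil => exact Nat.zero_le _
  | cons x env ih =>
    rw [List.forall_mem_cons] at h
    rw [Encodable.encode_list_cons, List.length_cons, listBound]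
    exact Nat.succ_le_succ (pair_le_pair h.1 (ih h.2))

lemma IsEnv.cons {p : ℕ} {env : List (ℕ × ℕ × ℕ)} (h : IsEnv p env) (hlt : env.length < p)
    {x : ℕ × ℕ × ℕ} (hx : x ∈ valRange p env.length) : IsEnv p (x :: env) := by
  refine ⟨hlt, List.forall_mem_cons.2 ⟨?_, h.2⟩⟩
  obtain ⟨s, hs, a, ha, b, hb, rfl⟩ := mem_valRange.1 hx
  have h1 : modulus (p + 2) (p - (env.length + 1)) ≤ modulus (p + 2) p :=
    Nat.le_of_dvd (modulus_pos _ _) (modulus_dvd (by lia))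
  have h2 : growth p ^ (env.length + 1) ≤ growth p ^ p :=
    Nat.pow_le_pow_right (by rw [growth]; lia) hlt
  exact pair_le_pair (Nat.le_of_lt_succ hs) (pair_le_pair (Nat.mul_le_mul h1 (ha.trans h2))
    (Nat.mul_le_mul h1 (hb.trans h2)))

/-- One step in the evaluation of a formula, given by `c` and `r` with `Nat.pair c r` its code.
The values of smaller formulas at assignments with a given code are found in `l`. -/
def formulaBody (p c r : ℕ) (l : List (Option Bool)) (env : List (ℕ × ℕ × ℕ)) : Option Bool :=
  if c = 0 then (if r = 0 then some false else none)
  else if c = 1 then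
    (termValue env r.unpair.1).bind fun x => (termValue env r.unpair.2).map fun y => eqVal x y
  else if c = 2 then
    (termValue env r.unpair.1).bind fun x => (termValue env r.unpair.2).map fun y => ltVal x y
  else if c = 3 then
    (lookup l (r.unpair.1 * envBound p + encode env)).bind fun x =>
      (lookup l (r.unpair.2 * envBound p + encode env)).map fun y => !x || y
  else if c = 4 then
    (valRange p env.length).foldr
      (fun d acc => andOpt (lookup l (r * envBound p + encode (d :: env))) acc) (some true)
  else none

/-- One step in the simultaneous evaluation of formulas at assignments. -/
def formulaStep (p : ℕ) (l : List (Option Bool)) : Option Bool :=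
  (decode (α := List (ℕ × ℕ × ℕ)) (l.length % envBound p)).bind fun env =>
    formulaBody p (l.length / envBound p).unpair.1 (l.length / envBound p).unpair.2 l env

/-- The truth value of the formula with code `k` at the assignment with code `e`, if defined. -/
def evalFormula (p k e : ℕ) : Option Bool := courseRec formulaStep p (k * envBound p + e)

lemma primrec_formulaStep : Primrec₂ formulaStep := by
  have hlen : Primrec fun q : ℕ × List (Option Bool) => q.2.length :=
    Primrec.list_length.comp Primrec.snd
  have hM : Primrec fun q : ℕ × List (Option Bool) => envBound q.1 :=
    primrec_envBound.comp Primrec.fst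
  refine Primrec.option_bind (Primrec.decode.comp (Primrec.nat_mod.comp hlen hM)) ?_
  have hp : Primrec fun q : (ℕ × List (Option Bool)) × List (ℕ × ℕ × ℕ) => q.1.1 :=
    Primrec.fst.comp Primrec.fst
  have hl : Primrec fun q : (ℕ × List (Option Bool)) × List (ℕ × ℕ × ℕ) => q.1.2 :=
    Primrec.snd.comp Primrec.fst
  have henv : Primrec fun q : (ℕ × List (Option Bool)) × List (ℕ × ℕ × ℕ) => q.2 := Primrec.snd
  have hM' := primrec_envBound.comp hp
  have hu : Primrec fun q : (ℕ × List (Option Bool)) × List (ℕ × ℕ × ℕ) =>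
      (q.1.2.length / envBound q.1.1).unpair :=
    Primrec.unpair.comp ((Primrec.nat_div.comp hlen hM).comp Primrec.fst)
  have hc := Primrec.fst.comp hu
  have hr := Primrec.snd.comp hu
  have hr' := Primrec.unpair.comp hr
  have hcase : ∀ i : ℕ, PrimrecPred fun q : (ℕ × List (Option Bool)) × List (ℕ × ℕ × ℕ) =>
      (q.1.2.length / envBound q.1.1).unpair.1 = i :=
    fun i => Primrec.eq.comp hc (Primrec.const i)
  have t1 := primrec_termValue.comp henv (Primrec.fst.comp hr')
  have t2 := primrec_termValue.comp henv (Primrec.snd.comp hr')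
  have f1 := primrec_lookup.comp hl (Primrec.nat_add.comp
    (Primrec.nat_mul.comp (Primrec.fst.comp hr') hM') (Primrec.encode.comp henv))
  have f2 := primrec_lookup.comp hl (Primrec.nat_add.comp
    (Primrec.nat_mul.comp (Primrec.snd.comp hr') hM') (Primrec.encode.comp henv))
  have himp : Primrec₂ fun x y : Bool => !x || y := Primrec.dom_finite _
  have hand : Primrec₂ andOpt := Primrec.dom_finite _
  refine Primrec.ite (hcase 0) (Primrec.ite (Primrec.eq.comp hr (Primrec.const 0))
    (Primrec.const _) (Primrec.const _)) ?_
  refine Primrec.ite (hcase 1) (Primrec.option_bind t1 (Primrec.option_map (t2.comp Primrec.fst)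
    (primrec_eqVal.comp (Primrec.snd.comp Primrec.fst) Primrec.snd))) ?_
  refine Primrec.ite (hcase 2) (Primrec.option_bind t1 (Primrec.option_map (t2.comp Primrec.fst)
    (primrec_ltVal.comp (Primrec.snd.comp Primrec.fst) Primrec.snd))) ?_
  refine Primrec.ite (hcase 3) (Primrec.option_bind f1 (Primrec.option_map (f2.comp Primrec.fst)
    (himp.comp (Primrec.snd.comp Primrec.fst) Primrec.snd))) ?_
  refine Primrec.ite (hcase 4) ?_ (Primrec.const none)
  refine Primrec.list_foldr
    (h := fun (q : (ℕ × List (Option Bool)) × List (ℕ × ℕ × ℕ))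
      (x : (ℕ × ℕ × ℕ) × Option Bool) => andOpt (lookup q.1.2
        ((q.1.2.length / envBound q.1.1).unpair.2 * envBound q.1.1 + encode (x.1 :: q.2))) x.2)
    (primrec_valRange.comp hp (Primrec.list_length.comp henv)) (Primrec.const _) ?_
  refine hand.comp (primrec_lookup.comp (hl.comp Primrec.fst) (Primrec.nat_add.comp
    ((Primrec.nat_mul.comp hr hM').comp Primrec.fst) (Primrec.encode.comp
      (Primrec.list_cons.comp (Primrec.fst.comp Primrec.snd) (henv.comp Primrec.fst)))))
    (Primrec.snd.comp Primrec.snd)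

/-- The final argument `0` is the code of the empty assignment. -/
lemma primrec_evalFormula_nil : Primrec fun k => evalFormula k k 0 :=
  (primrec_courseRec primrec_formulaStep).comp Primrec.id
    (Primrec.nat_add.comp (Primrec.nat_mul.comp Primrec.id primrec_envBound) (Primrec.const 0))

/-- The index `k * envBound p + e` orders pairs by the formula first. A subformula may therefore be
looked up at any admissible assignment, in particular at the longer ones that a quantifier produces.
-/
lemma lookup_history_formula {p k k' e e' : ℕ} (hk : k' < k) (he : e' < envBound p) :
    lookup (history formulaStep p (k * envBound p + e)) (k' * envBound p + e') =
      evalFormula p k' e' := by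
  refine lookup_history _ _ ?_
  have : (k' + 1) * envBound p ≤ k * envBound p := Nat.mul_le_mul_right _ hk
  rw [add_mul, one_mul] at this
  lia

lemma foldr_congr_mem {δ σ : Type} {f g : δ → σ → σ} {l : List δ} (b : σ)
    (h : ∀ d ∈ l, f d = g d) : l.foldr f b = l.foldr g b := by
  induction l with
  | nil => rfl
  | cons d l ih =>
    rw [List.forall_mem_cons] at h
    rw [List.foldr_cons, List.foldr_cons, ih h.2, h.1]

/-- Under a quantifier the assignment becomes longer, and `hlt` guarantees that its code still lies
below `envBound p`. -/
lemma evalFormula_pair {p c r : ℕ} {env : List (ℕ × ℕ × ℕ)} (h : IsEnv p env)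
    (hlt : c = 4 → env.length < p) : evalFormula p (Nat.pair c r) (encode env) =
    if c = 0 then (if r = 0 then some false else none)
    else if c = 1 then
      (termValue env r.unpair.1).bind fun x => (termValue env r.unpair.2).map fun y => eqVal x y
    else if c = 2 then
      (termValue env r.unpair.1).bind fun x => (termValue env r.unpair.2).map fun y => ltVal x y
    else if c = 3 then
      (evalFormula p r.unpair.1 (encode env)).bind fun x =>
        (evalFormula p r.unpair.2 (encode env)).map fun y => !x || y
    else if c = 4 then
      (valRange p env.length).foldr
        (fun d acc => andOpt (evalFormula p r (encode (d :: env))) acc) (some true)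
    else none := by
  have hM : 0 < envBound p := Nat.succ_pos _
  have hdiv : (Nat.pair c r * envBound p + encode env) / envBound p = Nat.pair c r := by
    rw [mul_comm, Nat.mul_add_div hM, Nat.div_eq_of_lt h.encode_lt, add_zero]
  have hmod : (Nat.pair c r * envBound p + encode env) % envBound p = encode env := by
    rw [mul_comm, Nat.mul_add_mod, Nat.mod_eq_of_lt h.encode_lt]
  conv_lhs => rw [evalFormula, courseRec, formulaStep]
  simp only [length_history, hdiv, hmod, Encodable.encodek, Option.bind_some, Nat.unpair_pair]
  rw [formulaBody]
  split_ifs with h0 hr h1 h2 h3 h4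
  · rfl
  · rfl
  · rfl
  · rfl
  · have hlt' := lt_pair_right (c := c) (r := r) (by lia)
    rw [lookup_history_formula ((Nat.unpair_left_le r).trans_lt hlt') h.encode_lt,
      lookup_history_formula ((Nat.unpair_right_le r).trans_lt hlt') h.encode_lt]
  · refine foldr_congr_mem _ fun d hd => funext fun acc => ?_
    rw [lookup_history_formula (lt_pair_right (by lia)) (h.cons (hlt h4) hd).encode_lt]
  · rfl

lemma listVal_cons {n : ℕ} {env : List (ℕ × ℕ × ℕ)} (hn : env.length = n) (x : ℕ × ℕ × ℕ) :
    listVal (n + 1) (x :: env) =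
      Fin.snoc (α := fun _ => SignType × ℤ) (listVal n env) (decodeVal x) := by
  subst hn
  funext i
  refine Fin.lastCases ?_ (fun i => ?_) i
  · rw [Fin.snoc_last]
    simp [listVal]
  · rw [Fin.snoc_castSucc]
    simp [listVal]

/-- The parameter `p`, the code of the whole sentence in the application, fixes the ranges and stays
constant while `φ` runs through subformulas; `n + code φ ≤ p` leaves room for all quantifiers in
`φ`. -/
lemma evalFormula_code {p : ℕ} : ∀ {n : ℕ} (φ : Lang.BoundedFormula Empty n)
    (env : List (ℕ × ℕ × ℕ)), env.length = n → IsEnv p env → n + code φ ≤ p →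
    ∃ b, evalFormula p (code φ) (encode env) = some b ∧
      (b = true ↔ Sat (intRange p) φ (listVal n env))
  | n, BoundedFormula.falsum, env, hn, h, hp => by
    refine ⟨false, ?_, by simp [Sat]⟩
    rw [code, evalFormula_pair h (by lia)]
    rfl
  | n, BoundedFormula.equal s t, env, hn, h, hp => by
    obtain ⟨x, hx, hx'⟩ := termValue_codeTerm hn s
    obtain ⟨y, hy, hy'⟩ := termValue_codeTerm hn t
    refine ⟨eqVal x y, ?_, ?_⟩
    · rw [code, evalFormula_pair h (by lia)]
      simp [hx, hy]
    · rw [eqVal_iff, hx', hy']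
      simp only [Sat]
  | n, BoundedFormula.rel Rel.lt ts, env, hn, h, hp => by
    obtain ⟨x, hx, hx'⟩ := termValue_codeTerm hn (ts 0)
    obtain ⟨y, hy, hy'⟩ := termValue_codeTerm hn (ts 1)
    refine ⟨ltVal x y, ?_, ?_⟩
    · rw [code, evalFormula_pair h (by lia)]
      simp [hx, hy]
    · rw [ltVal_iff, hx', hy']
      simp only [Sat]
  | n, BoundedFormula.imp φ ψ, env, hn, h, hp => by
    rw [code] at hp
    have h3 := Nat.add_le_pair 3 (Nat.pair (code φ) (code ψ))
    have h4 := Nat.add_le_pair (code φ) (code ψ)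
    obtain ⟨a, ha, ha'⟩ := evalFormula_code φ env hn h (by lia)
    obtain ⟨b, hb, hb'⟩ := evalFormula_code ψ env hn h (by lia)
    refine ⟨!a || b, ?_, ?_⟩
    · rw [code, evalFormula_pair h (by lia)]
      simp [ha, hb]
    · simp only [Sat, ← ha', ← hb']
      cases a <;> simp
  | n, BoundedFormula.all φ, env, hn, h, hp => by
    classical
    rw [code] at hp
    have h4 := Nat.add_le_pair 4 (code φ)
    have key : ∀ x ∈ valRange p n, ∃ b,
        evalFormula p (code φ) (encode (x :: env)) = some b ∧
          (b = true ↔ Sat (intRange p) φ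
            (Fin.snoc (α := fun _ => SignType × ℤ) (listVal n env) (decodeVal x))) := by
      intro x hx
      rw [← listVal_cons hn]
      exact evalFormula_code φ (x :: env) (by rw [List.length_cons, hn])
        (h.cons (by lia) (by rwa [hn])) (by lia)
    refine ⟨decide (∀ x ∈ valRange p n,
      evalFormula p (code φ) (encode (x :: env)) = some true), ?_, ?_⟩
    · rw [code, evalFormula_pair h fun _ => by lia]
      simp only [OfNat.ofNat_ne_zero, OfNat.ofNat_ne_one, Nat.reduceEqDiff, if_false, if_true]
      rw [hn, foldr_andOpt]
      refine ⟨fun x hx => ?_, by simp⟩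
      obtain ⟨b, hb, -⟩ := key x hx
      exact ⟨b, hb⟩
    · simp only [Sat]
      rw [decide_eq_true_eq, ← forall_valRange (P := fun y => Sat (intRange p) φ
        (Fin.snoc (α := fun _ => SignType × ℤ) (listVal n env) y))]
      refine forall₂_congr fun x hx => ?_
      obtain ⟨b, hb, hb'⟩ := key x hx
      rw [hb, Option.some_inj, hb']

/-- A converse to `evalFormula_code`: numbers that code no formula are rejected by being given no
truth value. -/
lemma exists_code_eq {p : ℕ} (k : ℕ) : ∀ (n : ℕ) (env : List (ℕ × ℕ × ℕ)), env.length = n →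
    IsEnv p env → n + k ≤ p → ∀ b, evalFormula p k (encode env) = some b →
    ∃ φ : Lang.BoundedFormula Empty n, code φ = k := by
  induction k using Nat.strong_induction_on with
  | _ k ih =>
    obtain ⟨c, r, rfl⟩ : ∃ c r, k = Nat.pair c r := ⟨_, _, (Nat.pair_unpair k).symm⟩
    intro n env hn h hp b hb
    have hle := Nat.add_le_pair c r
    rw [evalFormula_pair h fun _ => by lia] at hb
    split_ifs at hb with h0 hr h1 h2 h3 h4
    · exact ⟨BoundedFormula.falsum, by rw [h0, hr]; rfl⟩
    · obtain ⟨x, hx, hb⟩ := Option.bind_eq_some_iff.1 hb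
      obtain ⟨y, hy, -⟩ := Option.map_eq_some_iff.1 hb
      obtain ⟨s, hs⟩ := exists_codeTerm_eq hn _ x hx
      obtain ⟨t, ht⟩ := exists_codeTerm_eq hn _ y hy
      refine ⟨BoundedFormula.equal s t, ?_⟩
      rw [h1, ← Nat.pair_unpair r, ← hs, ← ht]
      rfl
    · obtain ⟨x, hx, hb⟩ := Option.bind_eq_some_iff.1 hb
      obtain ⟨y, hy, -⟩ := Option.map_eq_some_iff.1 hb
      obtain ⟨s, hs⟩ := exists_codeTerm_eq hn _ x hx
      obtain ⟨t, ht⟩ := exists_codeTerm_eq hn _ y hy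
      refine ⟨fLt s t, ?_⟩
      rw [h2, ← Nat.pair_unpair r, ← hs, ← ht]
      rfl
    · obtain ⟨x, hx, hb⟩ := Option.bind_eq_some_iff.1 hb
      obtain ⟨y, hy, -⟩ := Option.map_eq_some_iff.1 hb
      have h5 := Nat.unpair_left_le r
      have h6 := Nat.unpair_right_le r
      obtain ⟨φ, hφ⟩ := ih _ (by lia) n env hn h (by lia) x hx
      obtain ⟨ψ, hψ⟩ := ih _ (by lia) n env hn h (by lia) y hy
      refine ⟨φ.imp ψ, ?_⟩
      rw [h3, ← Nat.pair_unpair r, ← hφ, ← hψ]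
      rfl
    -- The range is nonempty, so the body has been evaluated at least once and its code has been
    -- checked; an empty conjunction would accept any `r`.
    · obtain ⟨x, hx⟩ := exists_mem_valRange p env.length
      obtain ⟨a, ha⟩ := ((foldr_andOpt _ _ _).1 hb).1 x hx
      obtain ⟨φ, hφ⟩ := ih r (by lia) (n + 1) (x :: env) (by rw [List.length_cons, hn])
        (h.cons (by lia) hx) (by lia) a ha
      refine ⟨φ.all, ?_⟩
      rw [h4, ← hφ]
      rfl

/-- The truth of a sentence in the reals is computed by the evaluator. -/
lemma exists_mem_completeTheory_iff (k : ℕ) :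
    (∃ φ : Lang.Sentence, φ ∈ Lang.completeTheory ℝ ∧ code φ = k) ↔
      evalFormula k k 0 = some true := by
  have hnil : IsEnv k [] := ⟨Nat.zero_le _, by simp⟩
  have key : ∀ φ : Lang.Sentence, code φ = k → ∃ b, evalFormula k k 0 = some b ∧
      (b = true ↔ ℝ ⊨ φ) := by
    rintro φ rfl
    obtain ⟨b, hb, hb'⟩ := evalFormula_code φ [] rfl hnil (by lia)
    refine ⟨b, hb, hb'.trans ?_⟩
    rw [real_models_iff_sat]
    exact iff_of_eq (congrArg _ (Subsingleton.elim _ _))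
  constructor
  · rintro ⟨φ, hφ, hk⟩
    obtain ⟨b, hb, hb'⟩ := key φ hk
    rw [hb, hb'.2 hφ]
  · intro h
    obtain ⟨φ, hφ⟩ := exists_code_eq k 0 [] rfl hnil (by lia) true h
    obtain ⟨b, hb, hb'⟩ := key φ hφ
    rw [h, Option.some_inj] at hb
    exact ⟨φ, hb'.1 hb.symm, hφ⟩

theorem decidableTheory_real : DecidableTheory (Lang.completeTheory ℝ) := by
  -- One test handles both false sentences, with value `some false`, and numbers that are not codes,
  -- with value `none`.
  have h : PrimrecPred fun k => evalFormula k k 0 = some true :=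
    Primrec.eq.comp primrec_evalFormula_nil (Primrec.const (some true))
  obtain ⟨_, h⟩ := h.of_eq fun k => (exists_mem_completeTheory_iff k).symm
  exact ⟨_, h.to_comp⟩

end Evaluation

end OrdMul

theorem mainTheorem2 :
    -- the axiom system is infinite
    OrdMul.realTheory.Infinite ∧
    -- its consequences are exactly the sentences that hold in the reals
    (∀ φ : OrdMul.Lang.Sentence, OrdMul.realTheory ⊨ᵇ φ ↔ ℝ ⊨ φ) ∧
    -- in particular it axiomatizes the theory of the reals with `<` and `×` alone
    (∀ φ : OrdMul.BaseLang.Sentence,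
      OrdMul.realTheory ⊨ᵇ OrdMul.incl.onSentence φ ↔ ℝ ⊨ φ) ∧
    OrdMul.HasQE OrdMul.Lang ℝ ∧
    OrdMul.DecidableTheory (OrdMul.Lang.completeTheory ℝ) :=
  ⟨OrdMul.realTheory_infinite, OrdMul.realTheory_models_iff, OrdMul.realTheory_models_base_iff,
    OrdMul.hasQE_real, OrdMul.decidableTheory_real⟩
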